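/- All graphs are finite and simple. Let $G$ be a connected graph and let $f$ assign a positive integer $f(v)$ to every vertex $v\in V(G)$. An $f$-coloring of $G$ is a coloring of the edges of $G$ in which, for every vertex $v$ and every color, at most $f(v)$ of the edges incident with $v$ have that color; the $f$-chromatic index $\chi'_f(G)$ is the minimum number of colors in an $f$-coloring of $G$. Put $\Delta_f(G)=\max_{v\in V(G)}\lceil d_G(v)/f(v)\rceil$, where $d_G(v)$ is the degree of $v$, and let the $f$-core $G_{\Delta_f}$ be the subgraph of $G$ induced on the set of vertices $v$ with $d_G(v)=f(v)\Delta_f(G)$. An edge cut of $G$ is a set of edges whose removal produces a graph with more connected components than $G$. **Theorem.** Suppose that the maximum degree of $G_{\Delta_f}$ is at most $2$ (the graph without vertices having maximum degree $0$), and that $G$ has an edge cut of size at most $\Delta_f(G)-2$ which is a matching (no two of its edges share an end) or a star (all its edges share a common end). Then $G$ is $f$-Class $1$, that is, $\chi'_f(G)=\Delta_f(G)$. -/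

import Mathlib

namespace FColoring

variable {V : Type*}

/-- An edge coloring `c` of `G` is an `f`-coloring if, at each vertex `v`, every color
occurs on at most `f v` of the edges incident with `v`. (Used on finite graphs, so that `ncard`
is the honest number of elements.) -/
def IsFColoring (G : SimpleGraph V) (f : V → ℕ) {α : Type*} (c : G.edgeSet → α) : Prop :=
  ∀ (v : V) (a : α), {e : G.edgeSet | v ∈ (e : Sym2 V) ∧ c e = a}.ncard ≤ f v

/-- `G` has an `f`-coloring with (at most) `k` colors. -/
def IsFColorable (G : SimpleGraph V) (f : V → ℕ) (k : ℕ) : Prop :=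
  ∃ c : G.edgeSet → Fin k, IsFColoring G f c

/-- If `f` is positive, a finite graph has an `f`-coloring: give all edges different colors.
Hence the infimum in `fChromaticIndex` below is a minimum. -/
theorem exists_isFColorable [Finite V] (G : SimpleGraph V) (f : V → ℕ) (hf : ∀ v, 0 < f v) :
    ∃ k, IsFColorable G f k := by
  obtain ⟨k, ⟨e⟩⟩ := Finite.exists_equiv_fin G.edgeSet
  refine ⟨k, e, fun v a => le_trans ?_ (hf v)⟩
  refine (Set.ncard_le_one (Set.toFinite _)).2 fun x hx y hy => ?_
  exact e.injective (hx.2.trans hy.2.symm)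

/-- The `f`-chromatic index: the minimum number of colors in an `f`-coloring of `G`. -/
noncomputable def fChromaticIndex (G : SimpleGraph V) (f : V → ℕ) : ℕ :=
  sInf {k | IsFColorable G f k}

open scoped Classical in
/-- `Δ_f(G)`, the maximum over all vertices `v` of `⌈d(v) / f(v)⌉`. -/
noncomputable def fMaxDegree [Fintype V] (G : SimpleGraph V) (f : V → ℕ) : ℕ :=
  Finset.univ.sup fun v => ⌈(G.degree v : ℚ) / (f v : ℚ)⌉₊

/-- `G` is `f`-Class 1. -/
def IsFClassOne [Fintype V] (G : SimpleGraph V) (f : V → ℕ) : Prop :=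
  fChromaticIndex G f = fMaxDegree G f

open scoped Classical in
/-- The set of `f`-maximum vertices. -/
def fMaxVertices [Fintype V] (G : SimpleGraph V) (f : V → ℕ) : Set V :=
  {v | G.degree v = f v * fMaxDegree G f}

/-- The `f`-core of `G`: the subgraph induced on the `f`-maximum vertices. -/
def fCore [Fintype V] (G : SimpleGraph V) (f : V → ℕ) : SimpleGraph (fMaxVertices G f) :=
  G.induce (fMaxVertices G f)

open scoped Classical in
/-- The maximum degree of the `f`-core (zero if the `f`-core has no vertices). -/
noncomputable def fCoreMaxDegree [Fintype V] (G : SimpleGraph V) (f : V → ℕ) : ℕ :=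
  (fCore G f).maxDegree

/-- An edge cut of `G`: a set of edges of `G` whose removal produces a graph with more
connected components than `G`. -/
def IsEdgeCut (G : SimpleGraph V) (F : Finset (Sym2 V)) : Prop :=
  (F : Set (Sym2 V)) ⊆ G.edgeSet ∧
    Nat.card G.ConnectedComponent <
      Nat.card (G.deleteEdges (F : Set (Sym2 V))).ConnectedComponent

/-- A set of edges is a matching if no two distinct members share an end. -/
def IsMatchingEdges (F : Finset (Sym2 V)) : Prop :=
  ∀ e ∈ F, ∀ e' ∈ F, e ≠ e' → ∀ v : V, ¬ (v ∈ e ∧ v ∈ e')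

/-- A set of edges of a simple graph is a star if its members all share a common end. -/
def IsStarEdges (F : Finset (Sym2 V)) : Prop :=
  ∃ u : V, ∀ e ∈ F, u ∈ e

end FColoring

/-!
Write `k` for `Δ_f(G)`. Vizing fans, together with exchanges of two colors along alternating
trails, show that an end `x` of an edge `xy` of a critical graph has at least
`2 + (f(y) k - d(y) - 1)` neighbors in the core. An alternating trail is encoded by pairing the
edges of the two colors at each vertex, so that trails are the orbits of two involutions on darts.
If core vertices have at most two neighbors in the core, this forces a critical subgraph to be a
union of components in which `f(v) k ≤ d(v) + 1` for all vertices `v`. So such a graph has an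
`f`-coloring with `k` colors whenever all its edges can be reached from a vertex `z` with
`f(z) = 1` and `d(z) ≤ k - 2`.

Given a cut of at most `k - 2` edges, contract one side of it to a vertex `z` with `f(z) = 1`. The
contracted graph is colorable, and the cut edges get distinct colors; after permuting the colors,
the colorings obtained from the two sides agree on the cut. For a matching the contracted graph is
simple. For a star with center `u` this is so on the side without `u`. On the side of `u` one
splits `u` instead: some of the inner edges at `u` are moved to `z`, and one edge of each color is
reserved at `u` for the edges moved to `z` and the cut edges. The split graph stays connected
unless the cut contains a bridge, and a bridge is itself a matching cut.
-/

namespace FColoring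

open Finset
open scoped Classical

section Involutions

variable {D : Type*}

theorem zpow_apply_eq_zpow_apply_iff (τ : Equiv.Perm D) (e : D) (i j : ℤ) :
    (τ ^ i) e = (τ ^ j) e ↔ (MulAction.period τ e : ℤ) ∣ i - j := by
  rw [← MulAction.zpow_smul_eq_iff_period_dvd, Equiv.Perm.smul_def, sub_eq_neg_add, zpow_add,
    Equiv.Perm.mul_apply, zpow_neg, Equiv.Perm.inv_eq_iff_eq]

variable {ι π : Equiv.Perm D}

theorem mul_zpow_neg_apply_of_fixed (hι : Function.Involutive ι) (hπ : Function.Involutive π)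
    {e : D} (he : π e = e) (i : ℤ) : π (((π * ι) ^ i) e) = ((π * ι) ^ (-i)) e := by
  have hπ_inv : π⁻¹ = π := Equiv.ext fun d => Equiv.Perm.inv_eq_iff_eq.2 (hπ d).symm
  have hι_inv : ι⁻¹ = ι := Equiv.ext fun d => Equiv.Perm.inv_eq_iff_eq.2 (hι d).symm
  have hconj : π * (π * ι) * π⁻¹ = (π * ι)⁻¹ := by
    have hππ : π * π = 1 := Equiv.ext hπ
    rw [mul_inv_rev, hπ_inv, hι_inv, ← mul_assoc, hππ, one_mul]
  rw [zpow_neg, ← inv_zpow, ← hconj, conj_zpow, hπ_inv, Equiv.Perm.mul_apply,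
    Equiv.Perm.mul_apply, he]

theorem mul_zpow_neg_succ_apply_of_fixed (hι : Function.Involutive ι)
    (hπ : Function.Involutive π) {e : D} (he : π e = e) (i : ℤ) :
    ι (((π * ι) ^ i) e) = ((π * ι) ^ (-(i + 1))) e := by
  rw [← mul_zpow_neg_apply_of_fixed hι hπ he (i + 1), add_comm, zpow_add, zpow_one,
    Equiv.Perm.mul_apply, Equiv.Perm.mul_apply, hπ]

theorem sameCycle_apply_of_fixed (hι : Function.Involutive ι) (hπ : Function.Involutive π)
    {e d : D} (he : π e = e) (h : (π * ι).SameCycle e d) :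
    (π * ι).SameCycle e (ι d) ∧ (π * ι).SameCycle e (π d) := by
  obtain ⟨i, rfl⟩ := h
  exact ⟨⟨_, (mul_zpow_neg_succ_apply_of_fixed hι hπ he i).symm⟩,
    ⟨_, (mul_zpow_neg_apply_of_fixed hι hπ he i).symm⟩⟩

theorem even_period_of_fixed (hι : Function.Involutive ι) (hπ : Function.Involutive π)
    (hfix : ∀ d, ι d ≠ d) {e : D} (he : π e = e) : Even (MulAction.period (π * ι) e) := by
  rw [← Nat.not_odd_iff_even]
  rintro ⟨j, hj⟩
  refine hfix (((π * ι) ^ (j : ℤ)) e) ?_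
  rw [mul_zpow_neg_succ_apply_of_fixed hι hπ he, zpow_apply_eq_zpow_apply_iff]
  exact ⟨-1, by omega⟩

/-- On the cycle `i ↦ (π * ι) ^ i e` of a fixed point `e` of `π`, the permutation `π` acts as the
reflection `i ↦ -i`; as `ι` has no fixed point the period is even, so the reflection fixes exactly
one more point of the cycle. -/
theorem exists_unique_fixed_of_sameCycle [Finite D] (hι : Function.Involutive ι)
    (hπ : Function.Involutive π) (hfix : ∀ d, ι d ≠ d) {e : D} (he : π e = e) :
    ∃ m, m ≠ e ∧ (π * ι).SameCycle e m ∧ π m = m ∧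
      ∀ d, (π * ι).SameCycle e d → π d = d → d = e ∨ d = m := by
  have hpos : 0 < MulAction.period (π * ι) e :=
    MulAction.period_pos_of_orderOf_pos (orderOf_pos _) e
  obtain ⟨j, hj⟩ := even_period_of_fixed hι hπ hfix he
  have eq_iff (i i' : ℤ) : ((π * ι) ^ i) e = ((π * ι) ^ i') e ↔ ((j + j : ℕ) : ℤ) ∣ i - i' := by
    rw [← hj, zpow_apply_eq_zpow_apply_iff]
  refine ⟨((π * ι) ^ (j : ℤ)) e, fun h => ?_, ⟨_, rfl⟩, ?_, ?_⟩
  · have hdvd := (eq_iff j 0).1 (by simpa using h)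
    rw [sub_zero, Int.natCast_dvd_natCast] at hdvd
    have := Nat.le_of_dvd (by omega) hdvd
    omega
  · rw [mul_zpow_neg_apply_of_fixed hι hπ he, eq_iff]
    exact ⟨-1, by omega⟩
  · rintro d ⟨i, rfl⟩ hd
    rw [mul_zpow_neg_apply_of_fixed hι hπ he, eq_iff] at hd
    obtain ⟨q, hq⟩ := hd
    have hi : i = -(j * q) := by push_cast at hq; linarith
    rcases Int.even_or_odd' q with ⟨r, hr | hr⟩
    · left
      simpa using (eq_iff i 0).2 ⟨-r, by rw [hi, hr]; push_cast; ring⟩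
    · right
      exact (eq_iff i j).2 ⟨-r - 1, by rw [hi, hr]; push_cast; ring⟩

theorem exists_involutive_maximal_matching [Finite D] (Γ : SimpleGraph D) :
    ∃ π : Equiv.Perm D, Function.Involutive π ∧ (∀ d, π d ≠ d → Γ.Adj d (π d)) ∧
      ∀ d d', π d = d → π d' = d' → ¬ Γ.Adj d d' := by
  let matching : Set (Equiv.Perm D) :=
    {π | Function.Involutive π ∧ ∀ d, π d ≠ d → Γ.Adj d (π d)}
  obtain ⟨π, ⟨hinv, hadj⟩, hmax⟩ := Set.exists_max_image matching
    (fun π => {d | π d ≠ d}.ncard) (Set.toFinite _) ⟨1, fun _ => rfl, fun _ h => absurd rfl h⟩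
  refine ⟨π, hinv, hadj, fun d d' hd hd' hdd' => ?_⟩
  have hne : d ≠ d' := hdd'.ne
  have apply_ne {e : D} (h : e ≠ d) (h' : e ≠ d') : π e ≠ d ∧ π e ≠ d' :=
    ⟨fun he => h (by rw [← hinv e, he, hd]), fun he => h' (by rw [← hinv e, he, hd'])⟩
  have swap_apply {e : D} (h : e ≠ d) (h' : e ≠ d') : (Equiv.swap d d' * π) e = π e := by
    rw [Equiv.Perm.mul_apply, Equiv.swap_apply_of_ne_of_ne (apply_ne h h').1 (apply_ne h h').2]
  have swap_left : (Equiv.swap d d' * π) d = d' := by simp [hd]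
  have swap_right : (Equiv.swap d d' * π) d' = d := by simp [hd']
  have hlarger : Equiv.swap d d' * π ∈ matching := by
    refine ⟨fun e => ?_, fun e he => ?_⟩ <;> rcases eq_or_ne e d with rfl | h
    · rw [swap_left, swap_right]
    · rcases eq_or_ne e d' with rfl | h'
      · rw [swap_right, swap_left]
      · rw [swap_apply h h', swap_apply (apply_ne h h').1 (apply_ne h h').2, hinv]
    · rwa [swap_left]
    · rcases eq_or_ne e d' with rfl | h'
      · rw [swap_right]
        exact hdd'.symm
      · rw [swap_apply h h'] at he ⊢
        exact hadj e he
  refine (hmax _ hlarger).not_gt (Set.ncard_lt_ncard ⟨fun e he => ?_, fun h => ?_⟩)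
  · have he_d : e ≠ d := fun h => he (h ▸ hd)
    have he_d' : e ≠ d' := fun h => he (h ▸ hd')
    rwa [Set.mem_ofPred_eq, swap_apply he_d he_d']
  · exact h (a := d) (by rw [Set.mem_ofPred_eq, swap_left]; exact hne.symm) hd

end Involutions

section ColorDegree

variable {V : Type*} [Fintype V] {α : Type*}

/-- The number of edges of color `a` at `v`. Colorings are taken to be defined on all of `Sym2 V`,
so that the same coloring can be used for several graphs on `V`. -/
noncomputable def colorDegree (G : SimpleGraph V) (c : Sym2 V → α) (v : V) (a : α) : ℕ :=
  #{w | G.Adj v w ∧ c s(v, w) = a}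

/-- The restriction of `c` to the edges of `G` is an `f`-coloring of `G`. -/
def IsFColoringOn (G : SimpleGraph V) (f : V → ℕ) (c : Sym2 V → α) : Prop :=
  ∀ v a, colorDegree G c v a ≤ f v

/-- The color `a` is missing at `v`: there is room at `v` for one more edge of color `a`. -/
def Misses (G : SimpleGraph V) (f : V → ℕ) (c : Sym2 V → α) (v : V) (a : α) : Prop :=
  colorDegree G c v a < f v

variable {G H : SimpleGraph V} {f : V → ℕ} {c : Sym2 V → α} {x y v w w' : V} {a q : α}

theorem colorDegree_le_card {A : Finset V} (h : ∀ w, G.Adj v w → c s(v, w) = a → w ∈ A) :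
    colorDegree G c v a ≤ #A :=
  card_le_card fun w hw => h w (mem_filter.1 hw).2.1 (mem_filter.1 hw).2.2

theorem eq_of_colorDegree_le_one (h : colorDegree G c v a ≤ 1) (hvw : G.Adj v w)
    (hw : c s(v, w) = a) (hvw' : G.Adj v w') (hw' : c s(v, w') = a) : w = w' :=
  card_le_one.1 h w (mem_filter.2 ⟨mem_univ _, hvw, hw⟩) w' (mem_filter.2 ⟨mem_univ _, hvw', hw'⟩)

theorem colorDegree_le_colorDegree_of_injOn {β : Type*} {c' : Sym2 V → β} {v' : V} {b : β}
    (φ : V → V) (hmap : ∀ w, G.Adj v w → c s(v, w) = a → H.Adj v' (φ w) ∧ c' s(v', φ w) = b)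
    (hinj : Set.InjOn φ (G.neighborSet v)) : colorDegree G c v a ≤ colorDegree H c' v' b := by
  refine card_le_card_of_injOn φ (fun w hw => ?_) (hinj.mono fun w hw => (mem_filter.1 hw).2.1)
  have ⟨_, hvw, hw⟩ := mem_filter.1 hw
  exact mem_filter.2 ⟨mem_univ _, hmap w hvw hw⟩

theorem degree_eq_sum_colorDegree [Fintype α] (G : SimpleGraph V) (c : Sym2 V → α) (v : V) :
    G.degree v = ∑ a, colorDegree G c v a := by
  rw [← G.card_neighborFinset_eq_degree, G.neighborFinset_eq_filter,
    card_eq_sum_card_fiberwise (f := fun w => c s(v, w)) (t := univ) (by simp)]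
  simp only [filter_filter, colorDegree]

theorem isFColoringOn_iff_isFColoring :
    IsFColoringOn G f c ↔ IsFColoring G f fun e : G.edgeSet => c e := by
  refine forall₂_congr fun v a => ?_
  have himage : Subtype.val '' {e : G.edgeSet | v ∈ (e : Sym2 V) ∧ c e = a} =
      (fun w => s(v, w)) '' ({w | G.Adj v w ∧ c s(v, w) = a} : Finset V) := by
    ext e
    simp only [Set.mem_image, Set.mem_ofPred_eq, Subtype.exists, exists_and_left, exists_prop,
      coe_filter, mem_univ, true_and]
    constructor
    · rintro ⟨_, ⟨hv, ha⟩, he, rfl⟩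
      obtain ⟨w, rfl⟩ := hv
      exact ⟨w, ⟨he, ha⟩, rfl⟩
    · rintro ⟨w, ⟨hvw, ha⟩, rfl⟩
      exact ⟨_, ⟨Sym2.mem_mk_left v w, ha⟩, hvw, rfl⟩
  rw [← Set.ncard_image_of_injective _ Subtype.val_injective, himage,
    Set.ncard_image_of_injective _ fun _ _ h => Sym2.congr_right.1 h, Set.ncard_coe_finset,
    colorDegree]

theorem isFColorable_iff {k : ℕ} (hk : 0 < k) :
    IsFColorable G f k ↔ ∃ c : Sym2 V → Fin k, IsFColoringOn G f c := by
  refine ⟨fun ⟨c, hc⟩ => ?_, fun ⟨c, hc⟩ => ⟨_, isFColoringOn_iff_isFColoring.1 hc⟩⟩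
  refine ⟨fun e => if he : e ∈ G.edgeSet then c ⟨e, he⟩ else ⟨0, hk⟩, ?_⟩
  simpa only [isFColoringOn_iff_isFColoring, Subtype.coe_prop, dite_true] using hc

theorem degree_le_of_isFColorable {k : ℕ} (h : IsFColorable G f k) (v : V) :
    G.degree v ≤ f v * k := by
  rcases k.eq_zero_or_pos with rfl | hk
  · obtain ⟨c, -⟩ := h
    rw [mul_zero, Nat.le_zero, G.degree_eq_zero_iff_notMem_support, G.mem_support]
    exact fun ⟨w, hvw⟩ => (c ⟨s(v, w), hvw⟩).elim0
  · obtain ⟨c, hc⟩ := (isFColorable_iff hk).1 h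
    rw [degree_eq_sum_colorDegree G c v, mul_comm]
    simpa using sum_le_card_nsmul univ _ _ fun a _ => hc v a

theorem colorDegree_update_le_succ (hGH : G.deleteEdges {s(x, y)} ≤ H) (c : Sym2 V → α) (a : α)
    (v : V) (q : α) :
    colorDegree G (Function.update c s(x, y) a) v q ≤ colorDegree H c v q + 1 := by
  have hcover : ({w | G.Adj v w ∧ Function.update c s(x, y) a s(v, w) = q} : Finset V) ⊆
      ({w | H.Adj v w ∧ c s(v, w) = q} : Finset V) ∪
        ({w | s(v, w) = s(x, y)} : Finset V) := by
    intro w hw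
    obtain ⟨-, hvw, hq⟩ := mem_filter.1 hw
    rw [mem_union, mem_filter, mem_filter]
    refine or_iff_not_imp_right.2 fun h => ⟨mem_univ _, ?_, ?_⟩ <;>
      simp only [mem_univ, true_and] at h
    · exact hGH (SimpleGraph.deleteEdges_adj.2 ⟨hvw, h⟩)
    · rwa [Function.update_of_ne h] at hq
  refine (card_le_card hcover).trans ((card_union_le _ _).trans (Nat.add_le_add_left ?_ _))
  exact card_le_one.2 fun w hw w' hw' =>
    Sym2.congr_right.1 ((mem_filter.1 hw).2.trans (mem_filter.1 hw').2.symm)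

theorem colorDegree_update_le (hGH : G.deleteEdges {s(x, y)} ≤ H) (c : Sym2 V → α)
    (h : v ∈ s(x, y) → q ≠ a) :
    colorDegree G (Function.update c s(x, y) a) v q ≤ colorDegree H c v q := by
  refine card_le_card fun w hw => ?_
  obtain ⟨-, hvw, hq⟩ := mem_filter.1 hw
  have hne : s(v, w) ≠ s(x, y) := by
    intro he
    rw [he, Function.update_self] at hq
    exact h (he ▸ Sym2.mem_mk_left v w) hq.symm
  rw [Function.update_of_ne hne] at hq
  exact mem_filter.2 ⟨mem_univ _, hGH (SimpleGraph.deleteEdges_adj.2 ⟨hvw, hne⟩), hq⟩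

theorem colorDegree_update_lt (hvw : G.Adj v w) (c : Sym2 V → α) (ha : c s(v, w) ≠ a) :
    colorDegree G (Function.update c s(v, w) a) v (c s(v, w)) <
      colorDegree G c v (c s(v, w)) := by
  refine card_lt_card (ssubset_iff_of_subset (fun u hu => ?_) |>.2 ⟨w, ?_, fun hw => ha ?_⟩)
  · obtain ⟨-, hvu, hu⟩ := mem_filter.1 hu
    have hne : s(v, u) ≠ s(v, w) := by
      intro he
      rw [he, Function.update_self] at hu
      exact ha hu.symm
    rw [Function.update_of_ne hne] at hu
    exact mem_filter.2 ⟨mem_univ _, hvu, hu⟩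
  · exact mem_filter.2 ⟨mem_univ _, hvw, rfl⟩
  · have hw := (mem_filter.1 hw).2.2
    rw [Function.update_self] at hw
    exact hw.symm

theorem IsFColoringOn.update (hc : IsFColoringOn H f c) (hGH : G.deleteEdges {s(x, y)} ≤ H)
    (hx : Misses H f c x a) (hy : Misses H f c y a) :
    IsFColoringOn G f (Function.update c s(x, y) a) := by
  intro v q
  by_cases h : v ∈ s(x, y) → q ≠ a
  · exact (colorDegree_update_le hGH c h).trans (hc v q)
  · obtain ⟨hv, rfl⟩ := Classical.not_imp.1 h |>.imp_right not_not.1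
    refine (colorDegree_update_le_succ hGH c q v q).trans ?_
    rcases Sym2.mem_iff.1 hv with rfl | rfl
    exacts [hx, hy]

end ColorDegree

section Fan

variable {β : Type*} {r : β → β → Prop} {s t : β}

theorem exists_reflTransGen_avoiding_of_ne (h : Relation.ReflTransGen r s t) (hne : s ≠ t) :
    ∃ u, Relation.ReflTransGen (fun v w => r v w ∧ v ≠ t ∧ w ≠ t) s u ∧ r u t := by
  induction h using Relation.ReflTransGen.head_induction_on with
  | refl => exact absurd rfl hne
  | @head s v hsv _ ih =>
    rcases eq_or_ne v t with rfl | hv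
    · exact ⟨s, .refl, hsv⟩
    · obtain ⟨u, hu, hut⟩ := ih hv
      exact ⟨u, .head ⟨hsv, hne, hv⟩ hu, hut⟩

variable {V : Type*} [Fintype V] {α : Type*}

/-- In a fan at `x`, the vertex `t` may follow the vertex `s` if the color of `xt` is missing at
`s`. -/
def FanStep (H : SimpleGraph V) (f : V → ℕ) (c : Sym2 V → α) (x s t : V) : Prop :=
  s ≠ x ∧ H.Adj x t ∧ Misses H f c s (c s(x, t))

/-- The vertices of the maximal fan at `x` that starts from `y`. -/
noncomputable def fan (H : SimpleGraph V) (f : V → ℕ) (c : Sym2 V → α) (x y : V) : Finset V :=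
  {t | Relation.ReflTransGen (FanStep H f c x) y t}

variable {G H : SimpleGraph V} {f : V → ℕ} {x y : V}

theorem mem_fan {c : Sym2 V → α} {t : V} :
    t ∈ fan H f c x y ↔ Relation.ReflTransGen (FanStep H f c x) y t := by
  simp only [fan, mem_filter, mem_univ, true_and]

/-- If `t ≠ y`, give `xt` the color `a`; this frees the old color of `xt` at `x`, and that color
is missing at the predecessor of `t` in the fan. -/
theorem exists_isFColoringOn_of_fan_within (hGH : G.deleteEdges {s(x, y)} ≤ H) (S : Finset V)
    {c : Sym2 V → α} {a : α} {t : V} (hc : IsFColoringOn H f c) (hx : Misses H f c x a)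
    (ht : Relation.ReflTransGen (fun u v => FanStep H f c x u v ∧ v ∈ S) y t)
    (hta : Misses H f c t a) : ∃ c' : Sym2 V → α, IsFColoringOn G f c' := by
  induction S using Finset.strongInduction generalizing c a t with
  | H S ih =>
  rcases eq_or_ne y t with rfl | hyt
  · exact ⟨_, hc.update hGH hx hta⟩
  obtain ⟨u, hu, ⟨hux, hxt, huc⟩, htS⟩ := exists_reflTransGen_avoiding_of_ne ht hyt
  rcases eq_or_ne (c s(x, t)) a with rfl | hne
  · exact ih _ (erase_ssubset htS) hc hx
      (hu.lift id fun v w h => ⟨h.1.1, mem_erase.2 ⟨h.2.2, h.1.2⟩⟩) huc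
  have hut : u ≠ t := by
    rcases hu.cases_tail with rfl | ⟨v, -, h⟩
    exacts [hyt, h.2.2]
  have misses_update {v : V} {q : α} (hvx : v ≠ x) (hvt : v ≠ t) (h : Misses H f c v q) :
      Misses H f (Function.update c s(x, t) a) v q :=
    (colorDegree_update_le (H.deleteEdges_le _) c
      fun hv => absurd (Sym2.mem_iff.1 hv) (not_or.2 ⟨hvx, hvt⟩)).trans_lt h
  refine ih _ (erase_ssubset htS) (hc.update (H.deleteEdges_le _) hx hta)
    ((colorDegree_update_lt hxt c hne).trans_le (hc _ _)) (hu.lift id ?_)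
    (misses_update hux hut huc)
  rintro v w ⟨⟨⟨hvx, hxw, hvc⟩, hwS⟩, hvt, hwt⟩
  refine ⟨⟨hvx, hxw, ?_⟩, mem_erase.2 ⟨hwt, hwS⟩⟩
  rw [id, id, Function.update_of_ne fun h => hwt (Sym2.congr_right.1 h)]
  exact misses_update hvx hvt hvc

variable (α H f x y) in
/-- In every `f`-coloring of `H` with colors in `α`, no color is missing both at `x` and at a vertex
of the fan at `x` that starts from `y`. -/
def IsFanElementary : Prop :=
  ∀ (c : Sym2 V → α) (a : α), IsFColoringOn H f c → Misses H f c x a →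
    ∀ t ∈ fan H f c x y, ¬ Misses H f c t a

theorem isFanElementary_of_not_isFColoringOn (hGH : G.deleteEdges {s(x, y)} ≤ H)
    (hG : ∀ c : Sym2 V → α, ¬ IsFColoringOn G f c) : IsFanElementary α H f x y := by
  intro c a hc hx t ht hta
  obtain ⟨c', hc'⟩ := exists_isFColoringOn_of_fan_within hGH univ hc hx
    ((mem_fan.1 ht).lift id fun u v h => ⟨h, mem_univ v⟩) hta
  exact hG c' hc'

theorem reflTransGen_fanStep_ne_or_exists_misses (c : Sym2 V → α) (b : α) {t : V}
    (ht : Relation.ReflTransGen (FanStep H f c x) y t) :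
    Relation.ReflTransGen (fun u v => FanStep H f c x u v ∧ c s(x, v) ≠ b) y t ∨
      ∃ s, Relation.ReflTransGen (fun u v => FanStep H f c x u v ∧ c s(x, v) ≠ b) y s ∧
        s ≠ x ∧ Misses H f c s b := by
  induction ht with
  | refl => exact .inl .refl
  | @tail u v _ huv ih =>
    refine ih.elim (fun hu => ?_) .inr
    by_cases hb : c s(x, v) = b
    · exact .inr ⟨u, hu, huv.1, hb ▸ huv.2.2⟩
    · exact .inl (hu.tail ⟨huv, hb⟩)

/-- If `b` is missing at a vertex reached without using the color `b`, then all edges of color `b`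
may follow that vertex. -/
theorem exists_reflTransGen_fanStep_eq (c : Sym2 V → α) (b : α) {t : V}
    (ht : Relation.ReflTransGen (FanStep H f c x) y t) :
    ∃ z, Relation.ReflTransGen (fun u v => FanStep H f c x u v ∧ (c s(x, v) = b → v = z)) y t := by
  obtain h | ⟨s, hs, hsx, hsb⟩ := reflTransGen_fanStep_ne_or_exists_misses c b ht
  · exact ⟨y, h.lift id fun u v h => ⟨h.1, fun hb => absurd hb h.2⟩⟩
  induction ht with
  | refl => exact ⟨y, .refl⟩
  | @tail u v _ huv ih =>
    by_cases hb : c s(x, v) = b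
    · refine ⟨v, .tail (hs.lift id fun u v h => ⟨h.1, fun hb => absurd hb h.2⟩) ?_⟩
      exact ⟨⟨hsx, huv.2.1, hb ▸ hsb⟩, fun _ => rfl⟩
    · obtain ⟨z, hz⟩ := ih
      exact ⟨z, hz.tail ⟨huv, fun h => absurd h hb⟩⟩

end Fan

section Kempe

variable {V : Type*} {α : Type*} {H : SimpleGraph V} {c : Sym2 V → α} {a b q : α}
  {K : Set H.Dart} {x v : V}

/-- The coloring obtained from `c` by exchanging the colors `a` and `b` on the edges of the darts
in `K`. -/
noncomputable def exchange (c : Sym2 V → α) (a b : α) (K : Set H.Dart) : Sym2 V → α := fun e =>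
  if ∃ d ∈ K, d.edge = e then Equiv.swap a b (c e) else c e

theorem exchange_edge_of_mem {d : H.Dart} (hd : d ∈ K) :
    exchange c a b K d.edge = Equiv.swap a b (c d.edge) :=
  if_pos ⟨d, hd, rfl⟩

theorem exchange_edge_of_notMem (hK : ∀ d ∈ K, d.symm ∈ K) {d : H.Dart} (hd : d ∉ K) :
    exchange c a b K d.edge = c d.edge := by
  refine if_neg ?_
  rintro ⟨d', hd', he⟩
  rcases SimpleGraph.dart_edge_eq_iff d' d |>.1 he with rfl | rfl
  · exact hd hd'
  · exact hd (by simpa using hK _ hd')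

/-- A maximal pairing of the darts of color `a` with the darts of color `b`, where paired darts
start at the same vertex, which is not `x`. The pairs describe how trails with alternating colors
`a` and `b` pass through the vertices; all these trails end when they reach `x`. -/
structure KempePairing (H : SimpleGraph V) (c : Sym2 V → α) (a b : α) (x : V) where
  perm : Equiv.Perm H.Dart
  involutive : Function.Involutive perm
  fst_perm : ∀ d, (perm d).fst = d.fst
  fst_ne : ∀ d, perm d ≠ d → d.fst ≠ x
  color_mem : ∀ d, perm d ≠ d → c d.edge = a ∨ c d.edge = b
  color_perm : ∀ d, perm d ≠ d → c (perm d).edge = Equiv.swap a b (c d.edge)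
  maximal : ∀ d d', perm d = d → perm d' = d' → d.fst = d'.fst → d.fst ≠ x →
    c d.edge = a → c d'.edge ≠ b

theorem nonempty_kempePairing (H : SimpleGraph V) [Finite H.Dart] (c : Sym2 V → α) (hab : a ≠ b)
    (x : V) : Nonempty (KempePairing H c a b x) := by
  obtain ⟨π, hinv, hadj, hmax⟩ := exists_involutive_maximal_matching <| SimpleGraph.fromRel
    fun d d' : H.Dart => d.fst = d'.fst ∧ d.fst ≠ x ∧ c d.edge = a ∧ c d'.edge = b
  refine ⟨⟨π, hinv, fun d => ?_, fun d hd => ?_, fun d hd => ?_, fun d hd => ?_,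
    fun d d' hd hd' hfst hx ha hb => hmax d d' hd hd' ⟨?_, .inl ⟨hfst, hx, ha, hb⟩⟩⟩⟩
  · by_cases hd : π d = d
    · rw [hd]
    · exact (hadj d hd).2.elim (fun h => h.1.symm) (fun h => h.1)
  · exact (hadj d hd).2.elim (fun h => h.2.1) (fun h => h.1 ▸ h.2.1)
  · exact (hadj d hd).2.imp (fun h => h.2.2.1) (fun h => h.2.2.2)
  · rcases (hadj d hd).2 with ⟨-, -, h, h'⟩ | ⟨-, -, h, h'⟩
    · rw [h, h', Equiv.swap_apply_left]
    · rw [h, h', Equiv.swap_apply_right]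
  · rintro rfl
    exact hab (ha.symm.trans hb)

namespace KempePairing

variable {P : KempePairing H c a b x} {σ σ' d : H.Dart}

variable (P) in
/-- A set of darts that is a union of complete alternating trails of the pairing. -/
def IsClosed (K : Set H.Dart) : Prop := ∀ d ∈ K, d.symm ∈ K ∧ P.perm d ∈ K

theorem perm_eq_of_fst_eq (hd : d.fst = x) : P.perm d = d :=
  not_imp_comm.1 (P.fst_ne d) (not_not.2 hd)

/-- Reversal of darts, as a permutation. -/
def dartSymm (H : SimpleGraph V) : Equiv.Perm H.Dart :=
  (SimpleGraph.Dart.symm_involutive (G := H)).toPerm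

variable (P) in
/-- The darts, in both directions, of the alternating trail through `σ`. -/
def chain (σ : H.Dart) : Set H.Dart := {d | (P.perm * dartSymm H).SameCycle σ d}

theorem mem_chain_self (σ : H.Dart) : σ ∈ P.chain σ := Equiv.Perm.SameCycle.refl _ _

theorem isClosed_chain (hσ : P.perm σ = σ) : P.IsClosed (P.chain σ) := fun _ hd =>
  sameCycle_apply_of_fixed SimpleGraph.Dart.symm_involutive P.involutive hσ hd

theorem color_perm_eq_or (hd : c d.edge = a ∨ c d.edge = b) :
    c (P.perm d).edge = a ∨ c (P.perm d).edge = b := by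
  by_cases hne : P.perm d = d
  · rwa [hne]
  · exact P.color_mem _ fun h => hne (P.perm.injective h)

section Mate

variable [Finite H.Dart]

theorem color_eq_or_of_mem_chain (hσ : c σ.edge = a ∨ c σ.edge = b) (hd : d ∈ P.chain σ) :
    c d.edge = a ∨ c d.edge = b := by
  obtain ⟨n, -, rfl⟩ := hd.exists_nat_pow_eq
  induction n with
  | zero => exact hσ
  | succ n ih =>
    rw [pow_succ', Equiv.Perm.mul_apply, Equiv.Perm.mul_apply]
    refine color_perm_eq_or ?_
    change c (SimpleGraph.Dart.symm _).edge = a ∨ c (SimpleGraph.Dart.symm _).edge = b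
    rw [SimpleGraph.Dart.edge_symm]
    exact ih ⟨n, rfl⟩

theorem exists_mate (hσ : P.perm σ = σ) :
    ∃ m, m ≠ σ ∧ m ∈ P.chain σ ∧ P.perm m = m ∧
      ∀ d, d ∈ P.chain σ → P.perm d = d → d = σ ∨ d = m :=
  exists_unique_fixed_of_sameCycle SimpleGraph.Dart.symm_involutive P.involutive
    SimpleGraph.Dart.symm_ne hσ

variable (P) in
/-- If a trail ends with the unpaired dart `σ`, then `P.mate σ` is the unpaired dart at its other
end. The value for a paired dart is irrelevant. -/
noncomputable def mate (σ : H.Dart) : H.Dart :=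
  if hσ : P.perm σ = σ then (exists_mate hσ).choose else σ

theorem mate_spec (hσ : P.perm σ = σ) :
    P.mate σ ≠ σ ∧ P.mate σ ∈ P.chain σ ∧ P.perm (P.mate σ) = P.mate σ ∧
      ∀ d, d ∈ P.chain σ → P.perm d = d → d = σ ∨ d = P.mate σ := by
  rw [mate, dif_pos hσ]
  exact (exists_mate hσ).choose_spec

theorem mate_injOn : Set.InjOn P.mate {σ | P.perm σ = σ} := by
  intro σ hσ σ' hσ' h
  obtain ⟨hne, hmem, -, -⟩ := mate_spec hσ
  obtain ⟨-, hmem', -, hunique⟩ := mate_spec hσ'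
  refine ((hunique σ ?_ hσ).resolve_right fun hm => hne (h.trans hm.symm))
  exact hmem'.trans (h ▸ hmem.symm)

end Mate

end KempePairing

variable [Fintype V]

/-- The darts of color `q` at `v` that belong to `K`. -/
noncomputable def dartsAt (K : Set H.Dart) (c : Sym2 V → α) (v : V) (q : α) : Finset H.Dart :=
  {d | d ∈ K ∧ d.fst = v ∧ c d.edge = q}

theorem mem_dartsAt {d : H.Dart} : d ∈ dartsAt K c v q ↔ d ∈ K ∧ d.fst = v ∧ c d.edge = q := by
  simp only [dartsAt, mem_filter, mem_univ, true_and]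

theorem card_dartsAt_univ (H : SimpleGraph V) (c : Sym2 V → α) (v : V) (q : α) :
    #(dartsAt (Set.univ : Set H.Dart) c v q) = colorDegree H c v q := by
  refine card_bij (fun d _ => d.snd) ?_ ?_ ?_
  · intro d hd
    obtain ⟨-, rfl, hq⟩ := mem_dartsAt.1 hd
    exact mem_filter.2 ⟨mem_univ _, d.adj, hq⟩
  · intro d hd d' hd' h
    exact SimpleGraph.Dart.ext _ _
      (Prod.ext ((mem_dartsAt.1 hd).2.1.trans (mem_dartsAt.1 hd').2.1.symm) h)
  · intro w hw
    obtain ⟨-, hvw, hq⟩ := mem_filter.1 hw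
    exact ⟨⟨(v, w), hvw⟩, mem_dartsAt.2 ⟨Set.mem_univ _, rfl, hq⟩, rfl⟩

theorem card_dartsAt_add_card_dartsAt_compl (K : Set H.Dart) (c : Sym2 V → α) (v : V) (q : α) :
    #(dartsAt K c v q) + #(dartsAt Kᶜ c v q) = colorDegree H c v q := by
  rw [← card_dartsAt_univ, ← card_union_of_disjoint]
  · congr 1
    ext d
    simp only [mem_union, mem_dartsAt, Set.mem_compl_iff, Set.mem_univ, true_and, ← or_and_right,
      em]
  · rw [disjoint_left]
    exact fun d hd hd' => (mem_dartsAt.1 hd').1 (mem_dartsAt.1 hd).1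

theorem colorDegree_exchange_add_card_dartsAt (hK : ∀ d ∈ K, d.symm ∈ K) (v : V) (q : α) :
    colorDegree H (exchange c a b K) v q + #(dartsAt K c v q) =
      colorDegree H c v q + #(dartsAt K c v (Equiv.swap a b q)) := by
  have hin : dartsAt K (exchange c a b K) v q = dartsAt K c v (Equiv.swap a b q) := by
    ext d
    simp only [mem_dartsAt]
    refine and_congr_right fun hd => and_congr_right fun _ => ?_
    rw [exchange_edge_of_mem hd, Equiv.swap_apply_eq_iff]
  have hout : dartsAt Kᶜ (exchange c a b K) v q = dartsAt Kᶜ c v q := by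
    ext d
    simp only [mem_dartsAt]
    refine and_congr_right fun hd => and_congr_right fun _ => ?_
    rw [exchange_edge_of_notMem hK hd]
  rw [← card_dartsAt_add_card_dartsAt_compl K, hin, hout,
    ← card_dartsAt_add_card_dartsAt_compl K c]
  omega

namespace KempePairing

variable {P : KempePairing H c a b x} {σ σ' d : H.Dart}

variable (P) in
/-- The darts of color `q` at `v` at which an alternating trail in `K` ends. -/
noncomputable def unpaired (K : Set H.Dart) (v : V) (q : α) : Finset H.Dart :=
  {d ∈ dartsAt K c v q | P.perm d = d}

theorem mem_unpaired {d : H.Dart} :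
    d ∈ P.unpaired K v q ↔ d ∈ K ∧ d.fst = v ∧ c d.edge = q ∧ P.perm d = d := by
  simp only [unpaired, mem_filter, mem_dartsAt, and_assoc]

theorem unpaired_subset (K : Set H.Dart) : P.unpaired K v q ⊆ P.unpaired Set.univ v q := by
  intro d
  simp only [mem_unpaired, Set.mem_univ, true_and]
  exact And.right

theorem card_dartsAt_add_card_unpaired (hK : P.IsClosed K) (v : V) (q : α) :
    #(dartsAt K c v q) + #(P.unpaired K v (Equiv.swap a b q)) =
      #(dartsAt K c v (Equiv.swap a b q)) + #(P.unpaired K v q) := by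
  have hpaired (r : α) : ∀ d ∈ ({d ∈ dartsAt K c v r | P.perm d ≠ d} : Finset _),
      P.perm d ∈ ({d ∈ dartsAt K c v (Equiv.swap a b r) | P.perm d ≠ d} : Finset _) := by
    intro d hd
    obtain ⟨⟨hdK, hfst, hcol⟩, hne⟩ := (mem_filter.1 hd).imp_left mem_dartsAt.1
    refine mem_filter.2 ⟨mem_dartsAt.2 ⟨(hK d hdK).2, (P.fst_perm d).trans hfst, ?_⟩, ?_⟩
    · rw [P.color_perm d hne, hcol]
    · rw [P.involutive]
      exact hne.symm
  have hcard : #{d ∈ dartsAt K c v q | P.perm d ≠ d} =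
      #{d ∈ dartsAt K c v (Equiv.swap a b q) | P.perm d ≠ d} := by
    refine card_bij' (fun d _ => P.perm d) (fun d _ => P.perm d) (hpaired q) (fun d hd => ?_)
      (fun d _ => P.involutive d) (fun d _ => P.involutive d)
    simpa only [Equiv.swap_apply_self] using hpaired _ d hd
  have hsplit (r : α) : #(P.unpaired K v r) + #{d ∈ dartsAt K c v r | P.perm d ≠ d} =
      #(dartsAt K c v r) := card_filter_add_card_filter_not _
  linarith [hsplit q, hsplit (Equiv.swap a b q)]

theorem colorDegree_exchange_add_card_unpaired (hK : P.IsClosed K) (v : V) (q : α) :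
    colorDegree H (exchange c a b K) v q + #(P.unpaired K v q) =
      colorDegree H c v q + #(P.unpaired K v (Equiv.swap a b q)) := by
  linarith [card_dartsAt_add_card_unpaired hK v q,
    colorDegree_exchange_add_card_dartsAt (a := a) (b := b) (c := c) (fun d hd => (hK d hd).1) v q]

theorem colorDegree_add_card_unpaired (P : KempePairing H c a b x) (v : V) (q : α) :
    colorDegree H c v q + #(P.unpaired Set.univ v (Equiv.swap a b q)) =
      colorDegree H c v (Equiv.swap a b q) + #(P.unpaired Set.univ v q) := by
  have huniv : P.IsClosed Set.univ := fun _ _ => ⟨trivial, trivial⟩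
  simpa only [card_dartsAt_univ] using card_dartsAt_add_card_unpaired huniv v q

theorem unpaired_eq_empty_or (P : KempePairing H c a b x) (K : Set H.Dart) (hv : v ≠ x) :
    P.unpaired K v a = ∅ ∨ P.unpaired K v b = ∅ := by
  by_contra! h
  obtain ⟨⟨d, hd⟩, d', hd'⟩ := h
  obtain ⟨-, rfl, hda, hd⟩ := mem_unpaired.1 hd
  obtain ⟨-, hdd', hdb, hd'⟩ := mem_unpaired.1 hd'
  exact P.maximal d d' hd hd' hdd'.symm hv hda hdb

theorem card_unpaired_swap (h : #(P.unpaired K v a) = #(P.unpaired K v b)) (q : α) :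
    #(P.unpaired K v (Equiv.swap a b q)) = #(P.unpaired K v q) := by
  by_cases hq : Equiv.swap a b q = q
  · rw [hq]
  · rcases Equiv.eq_or_eq_of_swap_apply_ne_self hq with rfl | rfl
    · rw [Equiv.swap_apply_left, h]
    · rw [Equiv.swap_apply_right, h]

theorem unpaired_eq_empty_of_lt (hv : v ≠ x)
    (hlt : #(P.unpaired K v q) < #(P.unpaired K v (Equiv.swap a b q))) :
    P.unpaired Set.univ v q = ∅ := by
  have hne : ¬ P.unpaired Set.univ v (Equiv.swap a b q) = ∅ := by
    intro h
    have hempty := subset_empty.1 (h ▸ P.unpaired_subset (v := v) (q := Equiv.swap a b q) K)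
    simp only [hempty, card_empty, not_lt_zero] at hlt
  have hswap : Equiv.swap a b q ≠ q := fun h => by simp only [h, lt_irrefl] at hlt
  rcases Equiv.eq_or_eq_of_swap_apply_ne_self hswap with rfl | rfl
  · exact (P.unpaired_eq_empty_or Set.univ hv).resolve_right (by rwa [Equiv.swap_apply_left] at hne)
  · exact (P.unpaired_eq_empty_or Set.univ hv).resolve_left (by rwa [Equiv.swap_apply_right] at hne)

theorem isFColoringOn_exchange {f : V → ℕ} (hc : IsFColoringOn H f c) (hK : P.IsClosed K)
    (hx : #(P.unpaired K x a) = #(P.unpaired K x b)) :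
    IsFColoringOn H f (exchange c a b K) := by
  intro v q
  have hexch := colorDegree_exchange_add_card_unpaired hK v q
  rcases le_or_gt #(P.unpaired K v (Equiv.swap a b q)) #(P.unpaired K v q) with hle | hlt
  · linarith [hc v q]
  have hvx : v ≠ x := by
    rintro rfl
    exact hlt.ne (card_unpaired_swap hx q).symm
  have huniv := colorDegree_add_card_unpaired P v q
  rw [unpaired_eq_empty_of_lt hvx hlt, card_empty] at huniv
  linarith [hc v (Equiv.swap a b q),
    card_le_card (P.unpaired_subset (v := v) (q := Equiv.swap a b q) K)]

end KempePairing

end Kempe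

section FanEnds

namespace KempePairing

variable {V : Type*} [Fintype V] {α : Type*} {H : SimpleGraph V} {f : V → ℕ} {c : Sym2 V → α}
  {a b : α} {x y t u z : V} {P : KempePairing H c a b x} {K : Set H.Dart} {σ σ₁ σ₂ d : H.Dart}

theorem colorDegree_exchange_eq (hK : P.IsClosed K)
    (h : #(P.unpaired K u a) = #(P.unpaired K u b)) (q : α) :
    colorDegree H (exchange c a b K) u q = colorDegree H c u q := by
  have hexch := colorDegree_exchange_add_card_unpaired hK u q
  rw [card_unpaired_swap h q] at hexch
  exact Nat.add_right_cancel hexch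

theorem unpaired_eq_empty_of_mem_fan (hel : IsFanElementary α H f x y) (hc : IsFColoringOn H f c)
    (hxa : Misses H f c x a) (hK : P.IsClosed K)
    (hx : #(P.unpaired K x a) = #(P.unpaired K x b)) (hu : u ∈ fan H f c x y)
    (hu' : u ∈ fan H f (exchange c a b K) x y) :
    P.unpaired K u a = ∅ ∧ P.unpaired K u b = ∅ := by
  have hc' := isFColoringOn_exchange hc hK hx
  have hxa' : Misses H f (exchange c a b K) x a := by
    rwa [Misses, colorDegree_exchange_eq hK hx]
  have hua := not_lt.1 (hel c a hc hxa u hu)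
  have hua' := not_lt.1 (hel _ a hc' hxa' u hu')
  have hux : u ≠ x := by
    rintro rfl
    exact hua.not_gt hxa
  have hexch := colorDegree_exchange_add_card_unpaired hK u a
  rw [Equiv.swap_apply_left, (hua.antisymm (hc u a)).symm, (hua'.antisymm (hc' u a)).symm] at hexch
  have heq : #(P.unpaired K u a) = #(P.unpaired K u b) := Nat.add_left_cancel hexch
  rcases P.unpaired_eq_empty_or K hux with h | h
  · exact ⟨h, card_eq_zero.1 (by rw [← heq, h, card_empty])⟩
  · exact ⟨card_eq_zero.1 (by rw [heq, h, card_empty]), h⟩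

/-- Exchanging the colors on `K` would free the color `a` at the fan vertex `σ.fst`, while keeping
the given fan path to that vertex and the color `a` missing at `x`. -/
theorem not_reflTransGen_of_isClosed (hel : IsFanElementary α H f x y) (hc : IsFColoringOn H f c)
    (hxa : Misses H f c x a) (hK : P.IsClosed K)
    (hx : #(P.unpaired K x a) = #(P.unpaired K x b)) (hσK : σ ∈ K) (hσ : P.perm σ = σ)
    (hσa : c σ.edge = a) :
    ¬ Relation.ReflTransGen (fun u v => FanStep H f c x u v ∧
      (c s(x, v) ≠ a → exchange c a b K s(x, v) = c s(x, v))) y σ.fst := by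
  have mem_fans {t : V} (ht : Relation.ReflTransGen (fun u v => FanStep H f c x u v ∧
      (c s(x, v) ≠ a → exchange c a b K s(x, v) = c s(x, v))) y t) :
      t ∈ fan H f c x y ∧ t ∈ fan H f (exchange c a b K) x y := by
    induction ht with
    | refl => exact ⟨mem_fan.2 .refl, mem_fan.2 .refl⟩
    | @tail u v _ huv ih =>
      obtain ⟨hu, hu'⟩ := ih
      obtain ⟨⟨hux, hxv, huc⟩, hkeep⟩ := huv
      refine ⟨mem_fan.2 ((mem_fan.1 hu).tail ⟨hux, hxv, huc⟩),
        mem_fan.2 ((mem_fan.1 hu').tail ⟨hux, hxv, ?_⟩)⟩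
      obtain ⟨hua, hub⟩ := unpaired_eq_empty_of_mem_fan hel hc hxa hK hx hu hu'
      rw [Misses, colorDegree_exchange_eq hK (by rw [hua, hub]), hkeep]
      · exact huc
      · intro hva
        exact hel c a hc hxa u hu (hva ▸ huc)
  intro hpath
  obtain ⟨ht, ht'⟩ := mem_fans hpath
  have hempty := (unpaired_eq_empty_of_mem_fan hel hc hxa hK hx ht ht').1
  exact notMem_empty σ (hempty ▸ mem_unpaired.2 ⟨hσK, rfl, hσa, hσ⟩)

variable (P f y) in
/-- The unpaired darts of color `a` at the vertices of the fan at `x` that starts from `y`. -/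
noncomputable def fanEnds : Finset H.Dart :=
  {σ | σ.fst ∈ fan H f c x y ∧ c σ.edge = a ∧ P.perm σ = σ}

theorem mem_fanEnds : σ ∈ P.fanEnds f y ↔ σ.fst ∈ fan H f c x y ∧ c σ.edge = a ∧ P.perm σ = σ := by
  simp only [fanEnds, mem_filter, mem_univ, true_and]

theorem sum_sub_colorDegree_le_card_fanEnds (hel : IsFanElementary α H f x y)
    (hc : IsFColoringOn H f c) (hxa : Misses H f c x a) :
    ∑ t ∈ fan H f c x y, (f t - colorDegree H c t b) ≤ #(P.fanEnds f y) := by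
  rw [card_eq_sum_card_fiberwise (f := fun σ : H.Dart => σ.fst) (t := fan H f c x y)
    fun σ hσ => (mem_fanEnds.1 hσ).1]
  refine sum_le_sum fun t ht => ?_
  have hfiber : P.unpaired Set.univ t a ⊆ {σ ∈ P.fanEnds f y | σ.fst = t} := by
    intro σ hσ
    obtain ⟨-, rfl, hσa, hσ⟩ := mem_unpaired.1 hσ
    exact mem_filter.2 ⟨mem_fanEnds.2 ⟨ht, hσa, hσ⟩, rfl⟩
  have hfull := not_lt.1 (hel c a hc hxa t ht)
  have hbalance := colorDegree_add_card_unpaired P t a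
  rw [Equiv.swap_apply_left] at hbalance
  have := card_le_card hfiber
  omega

theorem fst_ne_of_mem_fanEnds (hel : IsFanElementary α H f x y) (hc : IsFColoringOn H f c)
    (hxa : Misses H f c x a) (hσ : σ ∈ P.fanEnds f y) : σ.fst ≠ x := fun h =>
  hel c a hc hxa _ (mem_fanEnds.1 hσ).1 (h ▸ hxa)

theorem eq_mate_of_mem_chain (hel : IsFanElementary α H f x y) (hc : IsFColoringOn H f c)
    (hxa : Misses H f c x a) (hσ : σ ∈ P.fanEnds f y) (hd : d ∈ P.chain σ) (hdx : d.fst = x) :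
    d = P.mate σ :=
  ((mate_spec (mem_fanEnds.1 hσ).2.2).2.2.2 d hd (perm_eq_of_fst_eq hdx)).resolve_left fun h =>
    fst_ne_of_mem_fanEnds hel hc hxa hσ (h ▸ hdx)

theorem fst_mate_of_mem_fanEnds (hel : IsFanElementary α H f x y) (hc : IsFColoringOn H f c)
    (hxa : Misses H f c x a) (hσ : σ ∈ P.fanEnds f y) : (P.mate σ).fst = x := by
  by_contra hne
  obtain ⟨hfan, hσa, hfix⟩ := mem_fanEnds.1 hσ
  have hclosed := isClosed_chain hfix
  have hx : ∀ d ∈ P.chain σ, d.fst ≠ x := fun d hd hdx =>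
    hne (eq_mate_of_mem_chain hel hc hxa hσ hd hdx ▸ hdx)
  have hempty (q : α) : P.unpaired (P.chain σ) x q = ∅ := by
    refine eq_empty_of_forall_notMem fun d hd => ?_
    obtain ⟨hd, hdx, -⟩ := mem_unpaired.1 hd
    exact hx d hd hdx
  refine not_reflTransGen_of_isClosed hel hc hxa hclosed (by rw [hempty, hempty])
    (mem_chain_self σ) hfix hσa ((mem_fan.1 hfan).lift id fun u v h => ⟨h, fun _ => ?_⟩)
  exact exchange_edge_of_notMem (d := ⟨(x, v), h.2.1⟩) (fun d hd => (hclosed d hd).1)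
    fun hd => hx _ hd rfl

theorem unpaired_eq_singleton_mate (hel : IsFanElementary α H f x y) (hc : IsFColoringOn H f c)
    (hxa : Misses H f c x a) (hσ : σ ∈ P.fanEnds f y) (hK : P.chain σ ⊆ K) {q : α}
    (hq : c (P.mate σ).edge = q)
    (hunique : ∀ d ∈ K, d.fst = x → c d.edge = q → d = P.mate σ) :
    P.unpaired K x q = {P.mate σ} := by
  obtain ⟨-, hmem, hfix, -⟩ := mate_spec (mem_fanEnds.1 hσ).2.2
  ext d
  rw [mem_unpaired, mem_singleton]
  constructor
  · rintro ⟨hd, hdx, hdq, -⟩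
    exact hunique d hd hdx hdq
  · rintro rfl
    exact ⟨hK hmem, fst_mate_of_mem_fanEnds hel hc hxa hσ, hq, hfix⟩

/-- Otherwise one could exchange the colors on the trails of both `σ₁` and `σ₂`: at `x` this changes
no color degree, and the colored edges used by the fan path to `σ₁.fst` keep their colors. -/
theorem snd_mate_eq (hab : a ≠ b) (hel : IsFanElementary α H f x y) (hc : IsFColoringOn H f c)
    (hxa : Misses H f c x a) (hσ₁ : σ₁ ∈ P.fanEnds f y) (hσ₂ : σ₂ ∈ P.fanEnds f y)
    (h₁ : c (P.mate σ₁).edge = a) (h₂ : c (P.mate σ₂).edge = b)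
    (hz : Relation.ReflTransGen (fun u v => FanStep H f c x u v ∧ (c s(x, v) = b → v = z)) y
      σ₁.fst) : (P.mate σ₂).snd = z := by
  by_contra hne
  obtain ⟨-, hσ₁a, hfix₁⟩ := mem_fanEnds.1 hσ₁
  obtain ⟨-, -, hfix₂⟩ := mem_fanEnds.1 hσ₂
  set K : Set H.Dart := P.chain σ₁ ∪ P.chain σ₂
  have hK : P.IsClosed K := fun d hd =>
    hd.elim (fun hd => (isClosed_chain hfix₁ d hd).imp .inl .inl)
      fun hd => (isClosed_chain hfix₂ d hd).imp .inr .inr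
  have hKx {d : H.Dart} (hd : d ∈ K) (hdx : d.fst = x) : d = P.mate σ₁ ∨ d = P.mate σ₂ :=
    hd.imp (fun hd => eq_mate_of_mem_chain hel hc hxa hσ₁ hd hdx)
      fun hd => eq_mate_of_mem_chain hel hc hxa hσ₂ hd hdx
  have hmate₁ : P.unpaired K x a = {P.mate σ₁} :=
    unpaired_eq_singleton_mate hel hc hxa hσ₁ Set.subset_union_left h₁ fun d hd hdx hda =>
      (hKx hd hdx).resolve_right fun h => hab (hda.symm.trans (h ▸ h₂))
  have hmate₂ : P.unpaired K x b = {P.mate σ₂} :=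
    unpaired_eq_singleton_mate hel hc hxa hσ₂ Set.subset_union_right h₂ fun d hd hdx hdb =>
      (hKx hd hdx).resolve_left fun h => hab ((h ▸ h₁).symm.trans hdb)
  refine not_reflTransGen_of_isClosed hel hc hxa hK (by rw [hmate₁, hmate₂]; rfl)
    (.inl (mem_chain_self σ₁)) hfix₁ hσ₁a (hz.lift id fun u v h => ⟨h.1, fun hva => ?_⟩)
  refine exchange_edge_of_notMem (d := ⟨(x, v), h.1.2.1⟩) (fun d hd => (hK d hd).1) fun hd => ?_
  rcases hKx hd rfl with heq | heq
  · rw [← heq] at h₁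
    exact hva h₁
  · rw [← heq] at h₂ hne
    exact hne (h.2 h₂)

theorem card_fanEnds_filter_le (hel : IsFanElementary α H f x y) (hc : IsFColoringOn H f c)
    (hxa : Misses H f c x a) (q : α) :
    #{σ ∈ P.fanEnds f y | c (P.mate σ).edge = q} ≤ colorDegree H c x q := by
  rw [← card_dartsAt_univ]
  refine card_le_card_of_injOn P.mate (fun σ hσ => ?_) (mate_injOn.mono fun σ hσ => ?_)
  · obtain ⟨hσ, hq⟩ := mem_filter.1 hσ
    exact mem_dartsAt.2 ⟨trivial, fst_mate_of_mem_fanEnds hel hc hxa hσ, hq⟩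
  · exact (mem_fanEnds.1 (mem_filter.1 hσ).1).2.2

theorem card_fanEnds_filter_le_one (hab : a ≠ b) (hel : IsFanElementary α H f x y)
    (hc : IsFColoringOn H f c) (hxa : Misses H f c x a) (hσ₁ : σ₁ ∈ P.fanEnds f y)
    (h₁ : c (P.mate σ₁).edge = a) :
    #{σ ∈ P.fanEnds f y | c (P.mate σ).edge = b} ≤ 1 := by
  obtain ⟨z, hz⟩ := exists_reflTransGen_fanStep_eq c b (mem_fan.1 (mem_fanEnds.1 hσ₁).1)
  refine card_le_one.2 fun σ hσ σ' hσ' => ?_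
  obtain ⟨hσ, hσb⟩ := mem_filter.1 hσ
  obtain ⟨hσ', hσb'⟩ := mem_filter.1 hσ'
  refine mate_injOn (mem_fanEnds.1 hσ).2.2 (mem_fanEnds.1 hσ').2.2
    (SimpleGraph.Dart.ext _ _ (Prod.ext ?_ ?_))
  · exact (fst_mate_of_mem_fanEnds hel hc hxa hσ).trans
      (fst_mate_of_mem_fanEnds hel hc hxa hσ').symm
  · exact (snd_mate_eq hab hel hc hxa hσ₁ hσ h₁ hσb hz).trans
      (snd_mate_eq hab hel hc hxa hσ₁ hσ' h₁ hσb' hz).symm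

theorem card_fanEnds_le (P : KempePairing H c a b x) (hab : a ≠ b)
    (hel : IsFanElementary α H f x y) (hc : IsFColoringOn H f c) (hxa : Misses H f c x a) :
    #(P.fanEnds f y) ≤ f x := by
  have hsplit : #(P.fanEnds f y) ≤ #{σ ∈ P.fanEnds f y | c (P.mate σ).edge = a} +
      #{σ ∈ P.fanEnds f y | c (P.mate σ).edge = b} := by
    refine (card_le_card fun σ hσ => ?_).trans (card_union_le _ _)
    obtain ⟨-, hσa, hfix⟩ := mem_fanEnds.1 hσ
    rw [mem_union, mem_filter, mem_filter, ← and_or_left]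
    exact ⟨hσ, color_eq_or_of_mem_chain (.inl hσa) (mate_spec hfix).2.1⟩
  have ha := (card_fanEnds_filter_le hel hc hxa a (P := P)).trans_lt hxa
  have hb := (card_fanEnds_filter_le hel hc hxa b (P := P)).trans (hc x b)
  rcases ({σ ∈ P.fanEnds f y | c (P.mate σ).edge = a} : Finset _).eq_empty_or_nonempty with
    hempty | ⟨σ₁, hσ₁⟩
  · rw [hempty, card_empty, zero_add] at hsplit
    exact hsplit.trans hb
  · obtain ⟨hσ₁, h₁⟩ := mem_filter.1 hσ₁
    have := card_fanEnds_filter_le_one hab hel hc hxa hσ₁ h₁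
    omega

end KempePairing

theorem sum_sub_colorDegree_le {V : Type*} [Fintype V] {α : Type*} {H : SimpleGraph V} {f : V → ℕ}
    {c : Sym2 V → α} {a : α} {x y : V} (hel : IsFanElementary α H f x y)
    (hc : IsFColoringOn H f c) (hxa : Misses H f c x a) (b : α) :
    ∑ t ∈ fan H f c x y, (f t - colorDegree H c t b) ≤ f x := by
  rcases eq_or_ne a b with rfl | hab
  · rw [sum_eq_zero fun t ht => Nat.sub_eq_zero_of_le (not_lt.1 (hel c a hc hxa t ht))]
    exact Nat.zero_le _
  · obtain ⟨P⟩ := nonempty_kempePairing H c hab x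
    exact (KempePairing.sum_sub_colorDegree_le_card_fanEnds hel hc hxa).trans
      (P.card_fanEnds_le hab hel hc hxa)

end FanEnds

section Critical

variable {V : Type*} {G H : SimpleGraph V} {f : V → ℕ} {k : ℕ} {x y v w : V}

/-- The graph `G` has no `f`-coloring with `k` colors, but deleting any edge produces one. -/
def IsFCritical (G : SimpleGraph V) (f : V → ℕ) (k : ℕ) : Prop :=
  ¬ IsFColorable G f k ∧ ∀ x y, G.Adj x y → IsFColorable (G.deleteEdges {s(x, y)}) f k

theorem exists_isFCritical_le [Finite V] (hG : ¬ IsFColorable G f k) :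
    ∃ H ≤ G, IsFCritical H f k := by
  obtain ⟨H, hH⟩ := (Set.toFinite {H : SimpleGraph V | H ≤ G ∧ ¬ IsFColorable H f k}).exists_minimal
    ⟨G, le_rfl, hG⟩
  refine ⟨H, hH.prop.1, hH.prop.2, fun x y hxy => ?_⟩
  by_contra h
  have hle := hH.le_of_le ⟨(H.deleteEdges_le _).trans hH.prop.1, h⟩ (H.deleteEdges_le _)
  exact (SimpleGraph.deleteEdges_adj.1 (hle hxy)).2 rfl

variable [Fintype V]

theorem exists_misses_of_degree_lt {α : Type*} [Fintype α] (c : Sym2 V → α)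
    (h : G.degree v < f v * Fintype.card α) : ∃ a, Misses G f c v a := by
  by_contra! hfull
  have hsum : ∑ _a : α, f v ≤ ∑ a, colorDegree G c v a := sum_le_sum fun a _ => not_lt.1 (hfull a)
  rw [← degree_eq_sum_colorDegree, sum_const, card_univ, smul_eq_mul, mul_comm] at hsum
  exact h.not_ge hsum

theorem sum_sub_colorDegree_le_card_fan {α : Type*} {c : Sym2 V → α} {a : α}
    (hel : IsFanElementary α H f x y) (hxy : ¬ H.Adj x y) (hc : IsFColoringOn H f c)
    (hxa : Misses H f c x a) (b : α) :
    ∑ t ∈ fan H f c x y, (f t - colorDegree H c t b) ≤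
      #{z ∈ (fan H f c x y).erase y | c s(x, z) = b} := by
  rcases Nat.eq_zero_or_pos (∑ t ∈ fan H f c x y, (f t - colorDegree H c t b)) with hzero | hpos
  · exact hzero ▸ Nat.zero_le _
  obtain ⟨t, ht, htb⟩ := exists_ne_zero_of_sum_ne_zero hpos.ne'
  replace htb : Misses H f c t b := Nat.lt_of_sub_ne_zero htb
  have hxb : f x ≤ colorDegree H c x b := not_lt.1 fun hxb => hel c b hc hxb t ht htb
  refine (sum_sub_colorDegree_le hel hc hxa b).trans (hxb.trans (colorDegree_le_card ?_))
  intro z hxz hz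
  have htx : t ≠ x := fun h => hel c a hc hxa t ht (h ▸ hxa)
  exact mem_filter.2 ⟨mem_erase.2 ⟨fun h => hxy (h ▸ hxz),
    mem_fan.2 ((mem_fan.1 ht).tail ⟨htx, hxz, hz ▸ htb⟩)⟩, hz⟩

theorem sum_sub_degree_lt_card_fan {α : Type*} [Fintype α] {c : Sym2 V → α} {a : α}
    (hel : IsFanElementary α H f x y) (hxy : ¬ H.Adj x y) (hc : IsFColoringOn H f c)
    (hxa : Misses H f c x a) :
    ∑ t ∈ fan H f c x y, (f t * Fintype.card α - H.degree t) < #(fan H f c x y) :=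
  calc ∑ t ∈ fan H f c x y, (f t * Fintype.card α - H.degree t)
      = ∑ t ∈ fan H f c x y, ∑ b, (f t - colorDegree H c t b) := by
        refine sum_congr rfl fun t _ => ?_
        rw [degree_eq_sum_colorDegree H c t, sum_tsub_distrib _ (fun b _ => hc t b), sum_const,
          card_univ, smul_eq_mul, mul_comm]
    _ = ∑ b, ∑ t ∈ fan H f c x y, (f t - colorDegree H c t b) := sum_comm
    _ ≤ ∑ b, #{z ∈ (fan H f c x y).erase y | c s(x, z) = b} :=
        sum_le_sum fun b _ => sum_sub_colorDegree_le_card_fan hel hxy hc hxa b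
    _ = #((fan H f c x y).erase y) :=
        (card_eq_sum_card_fiberwise (f := fun z => c s(x, z)) (t := univ) (by simp)).symm
    _ < #(fan H f c x y) := card_erase_lt_of_mem (mem_fan.2 .refl)

theorem le_card_filter_eq_zero {ι : Type*} {T : Finset ι} {d : ι → ℕ} {i : ι} {n : ℕ} (hi : i ∈ T)
    (h : ∑ t ∈ T, d t + n ≤ #T) : n + (d i - 1) ≤ #{t ∈ T | d t = 0} := by
  have hone : ∑ t ∈ T.erase i, (if d t = 0 then 0 else 1) ≤ ∑ t ∈ T.erase i, d t :=
    sum_le_sum fun t _ => by split_ifs <;> omega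
  have hnonzero : #{t ∈ T | ¬ d t = 0} = ∑ t ∈ T, if d t = 0 then 0 else 1 := by
    simp only [card_filter, ite_not]
  rw [← add_sum_erase _ _ hi] at h hnonzero
  have hsplit : #{t ∈ T | d t = 0} + #{t ∈ T | ¬ d t = 0} = #T :=
    card_filter_add_card_filter_not _
  split_ifs at hnonzero <;> omega

/-- The neighbors of `v` among the vertices `w` with `d(w) = f(w) k`, which is the largest degree
possible in a graph with an `f`-coloring with `k` colors. For `k = Δ_f(G)` these `w` form the
`f`-core of `G`. -/
noncomputable def coreNeighbors (G : SimpleGraph V) (f : V → ℕ) (k : ℕ) (v : V) : Finset V :=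
  {w | G.Adj v w ∧ G.degree w = f w * k}

theorem mem_coreNeighbors :
    w ∈ coreNeighbors G f k v ↔ G.Adj v w ∧ G.degree w = f w * k := by
  simp only [coreNeighbors, mem_filter, mem_univ, true_and]

theorem degree_lt_degree_of_adj (hle : H ≤ G) (hG : G.Adj v w) (hH : ¬ H.Adj v w) :
    H.degree v < G.degree v := by
  rw [← H.card_neighborFinset_eq_degree, ← G.card_neighborFinset_eq_degree]
  refine card_lt_card ((ssubset_iff_of_subset fun u hu => ?_).2 ⟨w, ?_, ?_⟩)
  · simp only [SimpleGraph.mem_neighborFinset] at hu ⊢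
    exact hle hu
  · simpa only [SimpleGraph.mem_neighborFinset] using hG
  · simpa only [SimpleGraph.mem_neighborFinset] using hH

/-- A generalization of Vizing's adjacency lemma. -/
theorem IsFCritical.le_card_coreNeighbors (hG : IsFCritical G f k)
    (hdeg : ∀ v, G.degree v ≤ f v * k) (hxy : G.Adj x y) :
    2 + (f y * k - G.degree y - 1) ≤ #(coreNeighbors G f k x) := by
  obtain ⟨H, hH⟩ : ∃ H, H = G.deleteEdges {s(x, y)} := ⟨_, rfl⟩
  have hle : H ≤ G := hH ▸ G.deleteEdges_le _
  have hxyH : ¬ H.Adj x y := by simp [hH]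
  have hdx := (degree_lt_degree_of_adj hle hxy hxyH).trans_le (hdeg x)
  have hdy := degree_lt_degree_of_adj hle hxy.symm (hxyH ·.symm)
  have hk : 0 < k := Nat.pos_of_ne_zero fun hk => by simp [hk] at hdx
  obtain ⟨c, hc⟩ := (isFColorable_iff hk).1 (hG.2 x y hxy)
  rw [← hH] at hc
  obtain ⟨a, hxa⟩ := exists_misses_of_degree_lt (f := f) c (by rwa [Fintype.card_fin])
  have hel : IsFanElementary (Fin k) H f x y := isFanElementary_of_not_isFColoringOn hH.ge
    fun c hc => hG.1 ((isFColorable_iff hk).2 ⟨c, hc⟩)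
  have hsumH := sum_sub_degree_lt_card_fan hel hxyH hc hxa
  have hy : y ∈ fan H f c x y := mem_fan.2 .refl
  have hsum : ∑ t ∈ fan H f c x y, (f t * k - G.degree t) <
      ∑ t ∈ fan H f c x y, (f t * Fintype.card (Fin k) - H.degree t) := by
    rw [Fintype.card_fin]
    exact sum_lt_sum (fun t _ => Nat.sub_le_sub_left (SimpleGraph.degree_le_of_le hle) _)
      ⟨y, hy, by have := hdeg y; omega⟩
  have hsum_add_two : ∑ t ∈ fan H f c x y, (f t * k - G.degree t) + 2 ≤ #(fan H f c x y) := by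
    omega
  refine (le_card_filter_eq_zero hy hsum_add_two).trans (card_le_card fun t ht => ?_)
  obtain ⟨ht, hcore⟩ := mem_filter.1 ht
  refine mem_coreNeighbors.2 ⟨?_, (hdeg t).antisymm (Nat.le_of_sub_eq_zero hcore)⟩
  rcases (mem_fan.1 ht).cases_tail with rfl | ⟨u, -, hut⟩
  exacts [hxy, hle hut.2.1]

/-- The degrees of `G` are at most `f v * k`, as necessary for an `f`-coloring with `k` colors, and
the vertices where equality holds induce a subgraph of maximum degree at most two. -/
structure HasSparseCore (G : SimpleGraph V) (f : V → ℕ) (k : ℕ) : Prop where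
  degree_le : ∀ v, G.degree v ≤ f v * k
  card_coreNeighbors_le : ∀ v, G.degree v = f v * k → #(coreNeighbors G f k v) ≤ 2

theorem HasSparseCore.coreNeighbors_subset (hG : HasSparseCore G f k) (hle : H ≤ G) (v : V) :
    coreNeighbors H f k v ⊆ coreNeighbors G f k v := by
  intro w hw
  obtain ⟨hvw, hw⟩ := mem_coreNeighbors.1 hw
  exact mem_coreNeighbors.2 ⟨hle hvw,
    (hG.degree_le w).antisymm (hw ▸ SimpleGraph.degree_le_of_le hle)⟩

/-- By the adjacency lemma every non-isolated vertex `x` of `H` has a neighbor `u` in the core, and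
`u` has at least `2 + (f x * k - d(x) - 1)` neighbors in the core, hence exactly two. -/
theorem IsFCritical.adj_of_adj (hH : IsFCritical H f k) (hle : H ≤ G) (hG : HasSparseCore G f k)
    (hxy : H.Adj x y) :
    f x * k ≤ H.degree x + 1 ∧ ∀ w, G.Adj x w → H.Adj x w := by
  have hdegH (v : V) : H.degree v ≤ f v * k :=
    (SimpleGraph.degree_le_of_le hle).trans (hG.degree_le v)
  obtain ⟨u, hu⟩ : (coreNeighbors H f k x).Nonempty :=
    card_pos.1 (by have := hH.le_card_coreNeighbors hdegH hxy; omega)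
  obtain ⟨hxu, hu⟩ := mem_coreNeighbors.1 hu
  have hucore : G.degree u = f u * k :=
    (hG.degree_le u).antisymm (hu ▸ SimpleGraph.degree_le_of_le hle)
  have hadj := hH.le_card_coreNeighbors hdegH hxu.symm
  have htwo := hG.card_coreNeighbors_le u hucore
  have hsub := hG.coreNeighbors_subset hle u
  have hcard := card_le_card hsub
  have hdx := hdegH x
  refine ⟨by omega, ?_⟩
  by_contra! h
  obtain ⟨w, hw, hw'⟩ := h
  have hlt := degree_lt_degree_of_adj hle hw hw'
  have hxG := hG.degree_le x
  have hssub : coreNeighbors H f k u ⊂ coreNeighbors G f k u :=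
    (ssubset_iff_of_subset hsub).2 ⟨x, mem_coreNeighbors.2 ⟨hle hxu.symm, by omega⟩,
      fun h => by have := (mem_coreNeighbors.1 h).2; omega⟩
  have := card_lt_card hssub
  omega

/-- The non-isolated vertices of a critical subgraph form a union of components of `G`. -/
theorem exists_forall_reachable_of_not_isFColorable (hk : 0 < k) (hG : HasSparseCore G f k)
    (h : ¬ IsFColorable G f k) :
    ∃ r, ∀ v, G.Reachable r v → (∃ w, G.Adj v w) ∧ f v * k ≤ G.degree v + 1 := by
  obtain ⟨H, hle, hH⟩ := exists_isFCritical_le h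
  obtain ⟨r, hr⟩ : ∃ r, ∃ w, H.Adj r w := by
    by_contra! hempty
    refine hH.1 ((isFColorable_iff hk).2 ⟨fun _ => ⟨0, hk⟩, fun v q => ?_⟩)
    exact (colorDegree_le_card (A := ∅) fun w hvw _ => absurd hvw (hempty v w)).trans
      (Nat.zero_le _)
  have hH_adj {v : V} (hv : G.Reachable r v) : ∃ w, H.Adj v w := by
    rw [SimpleGraph.reachable_iff_reflTransGen] at hv
    induction hv with
    | refl => exact hr
    | @tail u v _ huv ih =>
      obtain ⟨w, huw⟩ := ih
      exact ⟨u, ((hH.adj_of_adj hle hG huw).2 v huv).symm⟩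
  refine ⟨r, fun v hv => ?_⟩
  obtain ⟨w, hvw⟩ := hH_adj hv
  exact ⟨⟨w, hle hvw⟩, (hH.adj_of_adj hle hG hvw).1.trans
    (Nat.add_le_add_right (SimpleGraph.degree_le_of_le hle) 1)⟩

theorem HasSparseCore.isFColorable_of_reachable {z : V} (hk : 0 < k) (hG : HasSparseCore G f k)
    (hz : G.degree z + 1 < f z * k) (hreach : ∀ v w, G.Adj v w → G.Reachable v z) :
    IsFColorable G f k := by
  by_contra h
  obtain ⟨r, hr⟩ := exists_forall_reachable_of_not_isFColorable hk hG h
  obtain ⟨w, hrw⟩ := (hr r .rfl).1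
  exact hz.not_ge (hr z (hreach r w hrw)).2

end Critical

section Boundary

variable {V : Type*} [Fintype V] {G : SimpleGraph V} {f : V → ℕ} {k : ℕ} {X : Set V} {u w : V}
  {e : Sym2 V} {F : Finset (Sym2 V)}

/-- The set of edges of `G` with exactly one end in `X`. -/
noncomputable def boundary (G : SimpleGraph V) (X : Set V) : Finset (Sym2 V) :=
  (G.between X Xᶜ).edgeFinset

theorem mk_mem_boundary_iff :
    s(u, w) ∈ boundary G X ↔ G.Adj u w ∧ (u ∈ X ∧ w ∉ X ∨ u ∉ X ∧ w ∈ X) := by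
  rw [boundary, SimpleGraph.mem_edgeFinset, SimpleGraph.mem_edgeSet, SimpleGraph.between_adj]
  rfl

theorem mk_mem_boundary (h : G.Adj u w) (hu : u ∈ X) (hw : w ∉ X) : s(u, w) ∈ boundary G X :=
  mk_mem_boundary_iff.2 ⟨h, .inl ⟨hu, hw⟩⟩

theorem mem_boundary : e ∈ boundary G X ↔ ∃ u w, s(u, w) = e ∧ G.Adj u w ∧ u ∈ X ∧ w ∉ X := by
  refine ⟨?_, fun ⟨u, w, he, h, hu, hw⟩ => he ▸ mk_mem_boundary h hu hw⟩
  induction e with | h u w => ?_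
  rw [mk_mem_boundary_iff]
  rintro ⟨h, ⟨hu, hw⟩ | ⟨hu, hw⟩⟩
  exacts [⟨u, w, rfl, h, hu, hw⟩, ⟨w, u, Sym2.eq_swap, h.symm, hw, hu⟩]

theorem boundary_compl (G : SimpleGraph V) (X : Set V) : boundary G Xᶜ = boundary G X := by
  ext e
  induction e with | h u w => ?_
  simp only [mk_mem_boundary_iff, Set.mem_compl_iff, not_not]
  tauto

/-- The edges of `G` with an end in `X` are colored by `c` so that the condition of an `f`-coloring
holds at the vertices of `X` and the edges leaving `X` receive distinct colors. -/
structure IsSideColoring (G : SimpleGraph V) (f : V → ℕ) (X : Set V) {α : Type*} (c : Sym2 V → α) :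
    Prop where
  colorDegree_le : ∀ v ∈ X, ∀ a, colorDegree G c v a ≤ f v
  injOn_boundary : Set.InjOn c (boundary G X)

theorem exists_perm_apply_eq_of_injOn {ι α : Type*} [Finite α] {g₁ g₂ : ι → α} {s : Set ι}
    (h₁ : Set.InjOn g₁ s) (h₂ : Set.InjOn g₂ s) : ∃ ρ : Equiv.Perm α, ∀ i ∈ s, ρ (g₂ i) = g₁ i := by
  let e₁ := Equiv.Set.imageOfInjOn g₁ s h₁
  let e₂ := Equiv.Set.imageOfInjOn g₂ s h₂
  refine ⟨(e₂.symm.trans e₁).extendSubtype, fun i hi => ?_⟩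
  have hi₂ : e₂.symm ⟨g₂ i, Set.mem_image_of_mem g₂ hi⟩ = ⟨i, hi⟩ := e₂.symm_apply_apply ⟨i, hi⟩
  rw [Equiv.extendSubtype_apply_of_mem _ _ (Set.mem_image_of_mem g₂ hi), Equiv.trans_apply, hi₂]
  rfl

theorem IsSideColoring.isFColorable {c₁ c₂ : Sym2 V → Fin k} (hk : 0 < k)
    (h₁ : IsSideColoring G f X c₁) (h₂ : IsSideColoring G f Xᶜ c₂) : IsFColorable G f k := by
  obtain ⟨ρ, hρ⟩ := exists_perm_apply_eq_of_injOn h₁.injOn_boundary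
    (boundary_compl G X ▸ h₂.injOn_boundary)
  let c : Sym2 V → Fin k := fun e => if ∃ v ∈ e, v ∈ X then c₁ e else ρ (c₂ e)
  have hc_left {v : V} (hv : v ∈ X) (w : V) : c s(v, w) = c₁ s(v, w) :=
    if_pos ⟨v, Sym2.mem_mk_left v w, hv⟩
  have hc_right {v w : V} (hvw : G.Adj v w) (hv : v ∉ X) : c s(v, w) = ρ (c₂ s(v, w)) := by
    by_cases hw : w ∈ X
    · rw [Sym2.eq_swap, hc_left hw, hρ _ (mk_mem_boundary hvw.symm hw hv)]
    · exact if_neg (by simp [hv, hw])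
  refine (isFColorable_iff hk).2 ⟨c, fun v a => ?_⟩
  by_cases hv : v ∈ X
  · refine (colorDegree_le_colorDegree_of_injOn id (fun w hw hwa => ⟨hw, ?_⟩)
      (Set.injOn_id _)).trans (h₁.colorDegree_le v hv a)
    rw [id, ← hc_left hv, hwa]
  · refine (colorDegree_le_colorDegree_of_injOn id (fun w hw hwa => ⟨hw, ?_⟩)
      (Set.injOn_id _)).trans (h₂.colorDegree_le v hv (ρ.symm a))
    rw [id, Equiv.eq_symm_apply, ← hc_right hw hv, hwa]

end Boundary

section Attach

variable {V : Type*} {G H K : SimpleGraph V} {X : Set V} {A : Finset V} {v w z : V}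

/-- The graph obtained from `K` by joining `z` to the vertices of `A`. Below, `z` is isolated in
`K` and stands for the other side of an edge cut. -/
def attachVertex (K : SimpleGraph V) (z : V) (A : Finset V) : SimpleGraph V :=
  K ⊔ SimpleGraph.fromRel fun p q => p = z ∧ q ∈ A

theorem le_attachVertex (K : SimpleGraph V) (z : V) (A : Finset V) : K ≤ attachVertex K z A :=
  le_sup_left

theorem attachVertex_adj :
    (attachVertex K z A).Adj v w ↔ K.Adj v w ∨ v ≠ w ∧ (v = z ∧ w ∈ A ∨ w = z ∧ v ∈ A) := by
  rw [attachVertex, SimpleGraph.sup_adj, SimpleGraph.fromRel_adj]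

theorem attachVertex_adj_right (hv : v ∈ A) (hvz : v ≠ z) : (attachVertex K z A).Adj v z :=
  attachVertex_adj.2 (.inr ⟨hvz, .inr ⟨rfl, hv⟩⟩)

theorem attachVertex_adj_of_ne (hvz : v ≠ z) :
    (attachVertex K z A).Adj v w ↔ K.Adj v w ∨ w = z ∧ v ∈ A := by
  rw [attachVertex_adj]
  constructor
  · rintro (h | ⟨-, ⟨h, -⟩ | h⟩)
    exacts [.inl h, absurd h hvz, .inr h]
  · rintro (h | ⟨rfl, h⟩)
    exacts [.inl h, .inr ⟨hvz, .inr ⟨rfl, h⟩⟩]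

theorem mem_of_attachVertex_adj_self (hKz : ∀ q, ¬ K.Adj z q) (h : (attachVertex K z A).Adj z w) :
    w ∈ A := by
  obtain h | ⟨hzw, ⟨-, h⟩ | ⟨h, -⟩⟩ := attachVertex_adj.1 h
  exacts [absurd h (hKz w), h, absurd h.symm hzw]

theorem reachable_of_forall_adj {r : V} (hX : ∀ p ∈ X, ∀ q, G.Adj p q →
      H.Reachable p r ∨ H.Adj p q ∧ q ∈ X) (hv : v ∈ X) (hvr : G.Reachable v r) :
    H.Reachable v r := by
  rw [SimpleGraph.reachable_iff_reflTransGen] at hvr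
  induction hvr using Relation.ReflTransGen.head_induction_on with
  | refl => rfl
  | @head p q hpq _ ih =>
    obtain h | ⟨h, hq⟩ := hX p hv q hpq
    exacts [h, h.reachable.trans (ih hq)]

variable [Fintype V] {f g : V → ℕ} {k : ℕ}

theorem degree_attachVertex_self_le (hKz : ∀ q, ¬ K.Adj z q) :
    (attachVertex K z A).degree z ≤ #A := by
  rw [← SimpleGraph.card_neighborFinset_eq_degree]
  refine card_le_card fun w hw => ?_
  rw [SimpleGraph.mem_neighborFinset] at hw
  exact mem_of_attachVertex_adj_self hKz hw

theorem degree_attachVertex_le (hKG : K ≤ G) (hvz : v ≠ z)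
    (hA : v ∈ A → ∃ q, G.Adj v q ∧ ¬ K.Adj v q) : (attachVertex K z A).degree v ≤ G.degree v := by
  rw [← SimpleGraph.card_neighborFinset_eq_degree, ← SimpleGraph.card_neighborFinset_eq_degree]
  refine (card_le_card (t := (G.neighborFinset v).image fun q => if K.Adj v q then q else z)
    fun w hw => ?_).trans card_image_le
  rw [SimpleGraph.mem_neighborFinset, attachVertex_adj_of_ne hvz] at hw
  simp only [mem_image, SimpleGraph.mem_neighborFinset]
  rcases hw with hw | ⟨rfl, hv⟩
  · exact ⟨w, hKG hw, if_pos hw⟩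
  · obtain ⟨q, hvq, hq⟩ := hA hv
    exact ⟨q, hvq, if_neg hq⟩

theorem colorDegree_le_colorDegree_attachVertex {α : Type*} {c c' : Sym2 V → α}
    (hKz : ∀ q, ¬ K.Adj z q) (hvz : v ≠ z) (hK : ∀ q, K.Adj v q → c s(v, q) = c' s(v, q))
    (hA : ∀ q, G.Adj v q → ¬ K.Adj v q → v ∈ A ∧ c s(v, q) = c' s(v, z))
    (hsub : (G.neighborSet v \ K.neighborSet v).Subsingleton) (a : α) :
    colorDegree G c v a ≤ colorDegree (attachVertex K z A) c' v a := by
  refine colorDegree_le_colorDegree_of_injOn (fun q => if K.Adj v q then q else z)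
    (fun q hq hqa => ?_) (fun q hq q' hq' heq => ?_)
  · split_ifs with h
    · exact ⟨le_attachVertex K z A h, hK q h ▸ hqa⟩
    · exact ⟨attachVertex_adj_right (hA q hq h).1 hvz, (hA q hq h).2 ▸ hqa⟩
  · dsimp only at heq
    have hzv : ¬ K.Adj v z := fun h => hKz v h.symm
    split_ifs at heq with h h' h'
    exacts [heq, absurd (heq ▸ h) hzv, absurd (heq ▸ h') hzv, hsub ⟨hq, h⟩ ⟨hq', h'⟩]

theorem HasSparseCore.isFColorable_attachVertex (hG : HasSparseCore G f k) (hKG : K ≤ G)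
    (hKz : ∀ q, ¬ K.Adj z q) (hA : #A + 2 ≤ k) (hgz : g z = 1)
    (hle : ∀ v ≠ z, (attachVertex K z A).degree v ≤ g v * k)
    (hcore : ∀ v ≠ z, ∀ w, (attachVertex K z A).Adj v w →
      (attachVertex K z A).degree v = g v * k → G.degree v = f v * k)
    (hreach : ∀ v ≠ z, ∀ w, (attachVertex K z A).Adj v w → (attachVertex K z A).Reachable v z) :
    IsFColorable (attachVertex K z A) g k := by
  have hdz := degree_attachVertex_self_le (A := A) hKz
  have ne_of_core {v : V} (hv : (attachVertex K z A).degree v = g v * k) : v ≠ z := by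
    rintro rfl
    rw [hgz] at hv
    omega
  refine HasSparseCore.isFColorable_of_reachable (z := z) (by omega) ⟨fun v => ?_, fun v hv => ?_⟩
    (by rw [hgz]; omega) fun v w hvw => ?_
  · rcases eq_or_ne v z with rfl | hvz
    · rw [hgz]
      omega
    · exact hle v hvz
  · rcases (coreNeighbors (attachVertex K z A) g k v).eq_empty_or_nonempty with hempty | ⟨w, hw⟩
    · simp [hempty]
    have hvG := hcore v (ne_of_core hv) w (mem_coreNeighbors.1 hw).1 hv
    refine (card_le_card fun q hq => ?_).trans (hG.card_coreNeighbors_le v hvG)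
    obtain ⟨hvq, hq⟩ := mem_coreNeighbors.1 hq
    have hKvq := ((attachVertex_adj_of_ne (ne_of_core hv)).1 hvq).resolve_right
      fun h => ne_of_core hq h.1
    exact mem_coreNeighbors.2 ⟨hKG hKvq, hcore q (ne_of_core hq) v hvq.symm hq⟩
  · rcases eq_or_ne v z with rfl | hvz
    exacts [.rfl, hreach v hvz w hvw]

end Attach

section Contraction

variable {V : Type*} {G : SimpleGraph V} {X : Set V} {v w z : V}

theorem spanningCoe_induce_adj :
    (G.induce X).spanningCoe.Adj v w ↔ G.Adj v w ∧ v ∈ X ∧ w ∈ X := by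
  rw [SimpleGraph.map_adj]
  constructor
  · rintro ⟨v, w, h, rfl, rfl⟩
    exact ⟨h, v.2, w.2⟩
  · rintro ⟨h, hv, hw⟩
    exact ⟨⟨v, hv⟩, ⟨w, hw⟩, h, rfl, rfl⟩

variable [Fintype V] {f : V → ℕ} {k : ℕ}

/-- The vertices of `X` with a neighbor outside `X`. -/
noncomputable def innerBoundary (G : SimpleGraph V) (X : Set V) : Finset V :=
  {v | v ∈ X ∧ ∃ w ∉ X, G.Adj v w}

theorem mem_innerBoundary : v ∈ innerBoundary G X ↔ v ∈ X ∧ ∃ w ∉ X, G.Adj v w := by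
  simp only [innerBoundary, mem_filter, mem_univ, true_and]

theorem card_innerBoundary_le (G : SimpleGraph V) (X : Set V) :
    #(innerBoundary G X) ≤ #(boundary G X) := by
  refine card_le_card_of_forall_subsingleton (fun v e => v ∈ e) (fun v hv => ?_) fun e he => ?_
  · obtain ⟨hv, w, hw, hvw⟩ := mem_innerBoundary.1 hv
    exact ⟨s(v, w), mk_mem_boundary hvw hv hw, Sym2.mem_mk_left v w⟩
  · obtain ⟨u, w, rfl, -, -, hw⟩ := mem_boundary.1 he
    have eq_left {v : V} (hv : v ∈ innerBoundary G X) (hve : v ∈ s(u, w)) : v = u :=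
      (Sym2.mem_iff.1 hve).resolve_right fun h => hw (h ▸ (mem_innerBoundary.1 hv).1)
    exact fun v hv v' hv' => (eq_left hv.1 hv.2).trans (eq_left hv'.1 hv'.2).symm

/-- The graph obtained from `G` by contracting the complement of `X` to the vertex `z`. -/
noncomputable def contractCompl (G : SimpleGraph V) (X : Set V) (z : V) : SimpleGraph V :=
  attachVertex (G.induce X).spanningCoe z (innerBoundary G X)

theorem isFColorable_contractCompl (hG : HasSparseCore G f k) (hconn : G.Preconnected) (hz : z ∉ X)
    (hcard : #(boundary G X) + 2 ≤ k) :
    IsFColorable (contractCompl G X z) (Function.update f z 1) k := by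
  have hKz (q : V) : ¬ (G.induce X).spanningCoe.Adj z q :=
    fun h => hz (spanningCoe_induce_adj.1 h).2.1
  have hKG := SimpleGraph.spanningCoe_induce_le (G := G) X
  have hdeg (v : V) (hvz : v ≠ z) : (contractCompl G X z).degree v ≤ G.degree v := by
    refine degree_attachVertex_le hKG hvz fun hv => ?_
    obtain ⟨-, w, hw, hvw⟩ := mem_innerBoundary.1 hv
    exact ⟨w, hvw, fun h => hw (spanningCoe_induce_adj.1 h).2.2⟩
  refine hG.isFColorable_attachVertex hKG hKz
    ((Nat.add_le_add_right (card_innerBoundary_le G X) 2).trans hcard) (Function.update_self ..)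
    (fun v hvz => ?_) (fun v hvz _ _ hv => ?_) fun v hvz w hvw => ?_
  · rw [Function.update_of_ne hvz]
    exact (hdeg v hvz).trans (hG.degree_le v)
  · rw [Function.update_of_ne hvz] at hv
    exact (hG.degree_le v).antisymm (hv ▸ hdeg v hvz)
  · have hv : v ∈ X := ((attachVertex_adj_of_ne hvz).1 hvw).elim
      (fun h => (spanningCoe_induce_adj.1 h).2.1) fun h => (mem_innerBoundary.1 h.2).1
    refine reachable_of_forall_adj (fun p hp q hpq => ?_) hv (hconn v z)
    by_cases hq : q ∈ X
    · exact .inr ⟨le_attachVertex _ _ _ (spanningCoe_induce_adj.2 ⟨hpq, hp, hq⟩), hq⟩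
    · exact .inl (attachVertex_adj_right (mem_innerBoundary.2 ⟨hp, q, hq, hpq⟩)
        (ne_of_mem_of_not_mem hp hz)).reachable

theorem isSideColoring_of_isFColoringOn_contractCompl {α : Type*} {c : Sym2 V → α} (hz : z ∉ X)
    (hX : ∀ v ∈ X, (G.neighborSet v \ X).Subsingleton)
    (hc : IsFColoringOn (contractCompl G X z) (Function.update f z 1) c) :
    IsSideColoring G f X fun e => c (e.map fun v => if v ∈ X then v else z) := by
  refine ⟨fun v hv a => ?_, ?_⟩
  · have hvz := ne_of_mem_of_not_mem hv hz
    have notMem_of_not_adj {q : V} (hvq : G.Adj v q)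
        (hq : ¬ (G.induce X).spanningCoe.Adj v q) : q ∉ X :=
      fun hqX => hq (spanningCoe_induce_adj.2 ⟨hvq, hv, hqX⟩)
    refine (colorDegree_le_colorDegree_attachVertex (fun q h => hz (spanningCoe_induce_adj.1 h).2.1)
      hvz (fun q hq => ?_) (fun q hvq hq => ?_) ((hX v hv).anti fun q hq => ?_) a).trans
      ((hc v a).trans_eq (Function.update_of_ne hvz _ _))
    · rw [Sym2.map_mk, if_pos hv, if_pos (spanningCoe_induce_adj.1 hq).2.2]
    · have hqX := notMem_of_not_adj hvq hq
      refine ⟨mem_innerBoundary.2 ⟨hv, q, hqX, hvq⟩, ?_⟩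
      rw [Sym2.map_mk, if_pos hv, if_neg hqX]
    · exact ⟨hq.1, notMem_of_not_adj hq.1 hq.2⟩
  · intro e he e' he' heq
    obtain ⟨u, w, rfl, huw, hu, hw⟩ := mem_boundary.1 he
    obtain ⟨u', w', rfl, huw', hu', hw'⟩ := mem_boundary.1 he'
    have adj_z {u w : V} (huw : G.Adj u w) (hu : u ∈ X) (hw : w ∉ X) :
        (contractCompl G X z).Adj z u :=
      (attachVertex_adj_right (mem_innerBoundary.2 ⟨hu, w, hw, huw⟩)
        (ne_of_mem_of_not_mem hu hz)).symm
    simp only [Sym2.map_mk, if_pos hu, if_pos hu', if_neg hw, if_neg hw'] at heq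
    obtain rfl : u = u' := eq_of_colorDegree_le_one
      ((hc z _).trans_eq (Function.update_self ..)) (adj_z huw hu hw)
      (congrArg c Sym2.eq_swap) (adj_z huw' hu' hw') ((congrArg c Sym2.eq_swap).trans heq.symm)
    rw [hX u hu ⟨huw, hw⟩ ⟨huw', hw'⟩]

theorem exists_isSideColoring_of_subsingleton (hG : HasSparseCore G f k) (hconn : G.Preconnected)
    (hz : z ∉ X) (hX : ∀ v ∈ X, (G.neighborSet v \ X).Subsingleton)
    (hcard : #(boundary G X) + 2 ≤ k) : ∃ c : Sym2 V → Fin k, IsSideColoring G f X c :=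
  have ⟨_, hc⟩ := (isFColorable_iff (by omega)).1 (isFColorable_contractCompl hG hconn hz hcard)
  ⟨_, isSideColoring_of_isFColoringOn_contractCompl hz hX hc⟩

theorem isFColorable_of_isMatchingEdges_boundary (hG : HasSparseCore G f k)
    (hconn : G.Preconnected) {x : V} (hx : x ∈ X) (hz : z ∉ X) (hcard : #(boundary G X) + 2 ≤ k)
    (hmatching : IsMatchingEdges (boundary G X)) : IsFColorable G f k := by
  have eq_of_mem {v w w' : V} (hw : s(v, w) ∈ boundary G X) (hw' : s(v, w') ∈ boundary G X) :
      w = w' := by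
    by_contra hne
    exact hmatching _ hw _ hw' (hne <| Sym2.congr_right.1 ·) v
      ⟨Sym2.mem_mk_left v w, Sym2.mem_mk_left v w'⟩
  obtain ⟨c₁, hc₁⟩ := exists_isSideColoring_of_subsingleton hG hconn hz
    (fun v hv w hw w' hw' =>
      eq_of_mem (mk_mem_boundary hw.1 hv hw.2) (mk_mem_boundary hw'.1 hv hw'.2)) hcard
  obtain ⟨c₂, hc₂⟩ := exists_isSideColoring_of_subsingleton (X := Xᶜ) hG hconn (not_not.2 hx)
    (fun v hv w hw w' hw' => by
      rw [← boundary_compl] at eq_of_mem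
      exact eq_of_mem (mk_mem_boundary hw.1 hv hw.2) (mk_mem_boundary hw'.1 hv hw'.2))
    (by rwa [boundary_compl])
  exact hc₁.isFColorable (by omega) hc₂

theorem isFColorable_of_card_boundary_le_one (hG : HasSparseCore G f k) (hconn : G.Preconnected)
    {x : V} (hx : x ∈ X) (hz : z ∉ X) (hcard : #(boundary G X) + 2 ≤ k)
    (hle : #(boundary G X) ≤ 1) : IsFColorable G f k :=
  isFColorable_of_isMatchingEdges_boundary hG hconn hx hz hcard
    fun e he e' he' hne => absurd (card_le_one.1 hle e he e' he') hne

end Contraction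

section Split

variable {V : Type*} {G : SimpleGraph V} {X : Set V} {A : Finset V} {b b' u v w z : V} {f : V → ℕ}

/-- The edges of `G` leaving `X` form a star with center `u ∈ X`, and `A` consists of neighbors of
`u` in `X`. -/
structure IsStarSplit (G : SimpleGraph V) (X : Set V) (u : V) (A : Finset V) : Prop where
  center_mem : u ∈ X
  eq_center : ∀ v ∈ X, ∀ w ∉ X, G.Adj v w → v = u
  mem_and_adj : ∀ w ∈ A, w ∈ X ∧ G.Adj u w

/-- The graph `G[X]` without the edges between `u` and `A`. -/
noncomputable def splitInner (G : SimpleGraph V) (X : Set V) (u : V) (A : Finset V) :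
    SimpleGraph V :=
  (G.induce X).spanningCoe.deleteEdges (A.image fun w => s(u, w))

/-- The graph obtained from `G[X]` by splitting `u`: the edges between `u` and `A` are moved to the
vertex `z`, which is to lie outside `X`. -/
noncomputable def splitGraph (G : SimpleGraph V) (X : Set V) (u z : V) (A : Finset V) :
    SimpleGraph V :=
  attachVertex (splitInner G X u A) z A

theorem splitInner_le (G : SimpleGraph V) (X : Set V) (u : V) (A : Finset V) :
    splitInner G X u A ≤ G :=
  (SimpleGraph.deleteEdges_le _).trans (SimpleGraph.spanningCoe_induce_le (G := G) X)

theorem splitInner_adj : (splitInner G X u A).Adj v w ↔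
    (G.Adj v w ∧ v ∈ X ∧ w ∈ X) ∧ ∀ q ∈ A, s(u, q) ≠ s(v, w) := by
  rw [splitInner, SimpleGraph.deleteEdges_adj, spanningCoe_induce_adj, mem_coe, mem_image]
  push Not
  rfl

theorem not_splitInner_adj (hz : z ∉ X) (q : V) : ¬ (splitInner G X u A).Adj z q :=
  fun h => hz (splitInner_adj.1 h).1.2.1

theorem not_splitInner_adj_center (hw : w ∈ A) : ¬ (splitInner G X u A).Adj u w :=
  fun h => (splitInner_adj.1 h).2 w hw rfl

theorem splitInner_adj_center (huw : G.Adj u w) (hu : u ∈ X) (hwX : w ∈ X) (hwA : w ∉ A) :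
    (splitInner G X u A).Adj u w :=
  splitInner_adj.2 ⟨⟨huw, hu, hwX⟩, fun _ hq h => hwA (Sym2.congr_right.1 h ▸ hq)⟩

theorem IsStarSplit.mem_of_splitGraph_adj (hs : IsStarSplit G X u A) (hvz : v ≠ z)
    (h : (splitGraph G X u z A).Adj v w) : v ∈ X :=
  ((attachVertex_adj_of_ne hvz).1 h).elim (fun h => (splitInner_adj.1 h).1.2.1)
    fun h => (hs.mem_and_adj v h.2).1

theorem IsStarSplit.splitInner_adj_of_ne (hs : IsStarSplit G X u A) (hv : v ∈ X) (hvu : v ≠ u)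
    (hvw : G.Adj v w) (hwu : w ≠ u) : (splitInner G X u A).Adj v w := by
  refine splitInner_adj.2 ⟨⟨hvw, hv, by_contra fun hw => hvu (hs.eq_center v hv w hw hvw)⟩, ?_⟩
  intro q _ h
  rcases Sym2.mem_iff.1 (h ▸ Sym2.mem_mk_left u q) with rfl | rfl
  exacts [hvu rfl, hwu rfl]

theorem IsStarSplit.eq_center_and_mem (hs : IsStarSplit G X u A) (hv : v ∈ X) (hvu : v ≠ u)
    (hvw : G.Adj v w) (h : ¬ (splitInner G X u A).Adj v w) : w = u ∧ v ∈ A := by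
  obtain rfl : w = u := by_contra fun hwu => h (hs.splitInner_adj_of_ne hv hvu hvw hwu)
  exact ⟨rfl, by_contra fun hvA => h (splitInner_adj_center hvw.symm hs.center_mem hv hvA).symm⟩

theorem IsStarSplit.splitGraph_reachable_of_ne (hs : IsStarSplit G X u A) (hv : v ∈ X)
    (hvu : v ≠ u) (hvb : (G.deleteIncidenceSet u).Reachable v b) :
    (splitGraph G X u z A).Reachable v b := by
  refine reachable_of_forall_adj (X := X \ {u}) (fun p hp q hpq => ?_) ⟨hv, hvu⟩ hvb
  obtain ⟨hpq, hpu, hqu⟩ := SimpleGraph.deleteIncidenceSet_adj.1 hpq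
  have h := hs.splitInner_adj_of_ne hp.1 hpu hpq hqu
  exact .inr ⟨le_attachVertex _ _ _ h, (splitInner_adj.1 h).1.2.2, hqu⟩

theorem IsStarSplit.splitGraph_reachable (hs : IsStarSplit G X u A) (hconn : G.Preconnected)
    (hz : z ∉ X)
    (hu : ∀ w, (splitInner G X u A).Adj u w → (splitGraph G X u z A).Reachable u z)
    (hvz : v ≠ z) (hvw : (splitGraph G X u z A).Adj v w) :
    (splitGraph G X u z A).Reachable v z := by
  rcases eq_or_ne v u with rfl | hvu
  · exact ((attachVertex_adj_of_ne hvz).1 hvw).elim (hu w)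
      fun h => absurd (hs.mem_and_adj v h.2).2 G.irrefl
  refine reachable_of_forall_adj (X := X \ {u}) (fun p hp q hpq => ?_)
    ⟨hs.mem_of_splitGraph_adj hvz hvw, hvu⟩ (hconn v z)
  by_cases h : (splitInner G X u A).Adj p q
  · rcases eq_or_ne q u with rfl | hqu
    · exact .inl ((le_attachVertex _ _ _ h).reachable.trans (hu p h.symm))
    · exact .inr ⟨le_attachVertex _ _ _ h, (splitInner_adj.1 h).1.2.2, hqu⟩
  · exact .inl (attachVertex_adj_right (hs.eq_center_and_mem hp.1 hp.2 hpq h).2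
      (ne_of_mem_of_not_mem hp.1 hz)).reachable

/-- The bounds on the color degrees of the split graph: of the `f u` edges of one color allowed at
`u`, one is reserved for the edges at `z` and the edges leaving `X`. -/
noncomputable def splitBound (f : V → ℕ) (u z : V) : V → ℕ :=
  Function.update (Function.update f u (f u - 1)) z 1

theorem splitBound_self : splitBound f u z z = 1 :=
  Function.update_self ..

theorem splitBound_center (huz : u ≠ z) : splitBound f u z u = f u - 1 := by
  rw [splitBound, Function.update_of_ne huz, Function.update_self]

theorem splitBound_of_ne (hvu : v ≠ u) (hvz : v ≠ z) : splitBound f u z v = f v := by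
  rw [splitBound, Function.update_of_ne hvz, Function.update_of_ne hvu]

variable [Fintype V] {k : ℕ}

/-- The neighbors of `u` in `X`. -/
noncomputable def innerNeighbors (G : SimpleGraph V) (X : Set V) (u : V) : Finset V :=
  {w | w ∈ X ∧ G.Adj u w}

theorem mem_innerNeighbors : w ∈ innerNeighbors G X u ↔ w ∈ X ∧ G.Adj u w := by
  simp only [innerNeighbors, mem_filter, mem_univ, true_and]

theorem IsStarSplit.card_innerNeighbors_add_card_boundary (hs : IsStarSplit G X u A) :
    #(innerNeighbors G X u) + #(boundary G X) = G.degree u := by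
  have hboundary : boundary G X = ({w | G.Adj u w ∧ w ∉ X} : Finset V).image fun w => s(u, w) := by
    ext e
    simp only [mem_boundary, mem_image, mem_filter, mem_univ, true_and]
    constructor
    · rintro ⟨v, w, rfl, hvw, hv, hw⟩
      obtain rfl := hs.eq_center v hv w hw hvw
      exact ⟨w, ⟨hvw, hw⟩, rfl⟩
    · rintro ⟨w, ⟨huw, hw⟩, rfl⟩
      exact ⟨u, w, rfl, huw, hs.center_mem, hw⟩
  rw [hboundary, card_image_of_injective _ fun _ _ h => Sym2.congr_right.1 h, ← filter_filter,
    ← G.card_neighborFinset_eq_degree, G.neighborFinset_eq_filter,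
    ← card_filter_add_card_filter_not (s := ({w | G.Adj u w} : Finset V)) (fun w => w ∈ X),
    innerNeighbors]
  simp only [filter_filter, and_comm]

theorem IsStarSplit.degree_splitGraph_center_add_card (hs : IsStarSplit G X u A) (hz : z ∉ X) :
    (splitGraph G X u z A).degree u + #A ≤ #(innerNeighbors G X u) := by
  have hA : A ⊆ innerNeighbors G X u := fun w hw => mem_innerNeighbors.2 (hs.mem_and_adj w hw)
  have hsub : (splitGraph G X u z A).neighborFinset u ⊆ innerNeighbors G X u \ A := by
    intro w hw
    rw [SimpleGraph.mem_neighborFinset, splitGraph,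
      attachVertex_adj_of_ne (ne_of_mem_of_not_mem hs.center_mem hz)] at hw
    have hw := hw.resolve_right fun h => G.irrefl (hs.mem_and_adj u h.2).2
    obtain ⟨huw, -, hwX⟩ := (splitInner_adj.1 hw).1
    exact mem_sdiff.2 ⟨mem_innerNeighbors.2 ⟨hwX, huw⟩, fun hwA => not_splitInner_adj_center hwA hw⟩
  rw [← SimpleGraph.card_neighborFinset_eq_degree, ← card_sdiff_add_card_eq_card hA]
  exact Nat.add_le_add_right (card_le_card hsub) _

theorem IsStarSplit.degree_splitGraph_le (hs : IsStarSplit G X u A) (hvz : v ≠ z) :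
    (splitGraph G X u z A).degree v ≤ G.degree v :=
  degree_attachVertex_le (splitInner_le G X u A) hvz fun hv =>
    ⟨u, (hs.mem_and_adj v hv).2.symm, fun h => not_splitInner_adj_center hv h.symm⟩

theorem IsStarSplit.isFColorable_splitGraph (hs : IsStarSplit G X u A) (hG : HasSparseCore G f k)
    (hconn : G.Preconnected) (hz : z ∉ X) (hcard : #A + 2 ≤ k)
    (hA : A = innerNeighbors G X u ∨ #A + #(boundary G X) = k ∧
      ∃ b' ∈ innerNeighbors G X u \ A, ∃ b ∈ A, (G.deleteIncidenceSet u).Reachable b' b) :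
    IsFColorable (splitGraph G X u z A) (splitBound f u z) k := by
  have huz := ne_of_mem_of_not_mem hs.center_mem hz
  have hdeg_center := hs.degree_splitGraph_center_add_card hz
  have hdeg : (splitGraph G X u z A).degree u = 0 ∨
      (splitGraph G X u z A).degree u + k ≤ G.degree u :=
    hA.imp (fun h => by rw [← h] at hdeg_center; omega)
      fun h => by have := hs.card_innerNeighbors_add_card_boundary; omega
  have hreach (w : V) (hw : (splitInner G X u A).Adj u w) :
      (splitGraph G X u z A).Reachable u z := by
    obtain rfl | ⟨-, b', hb', b, hb, hbb'⟩ := hA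
    · obtain ⟨huw, -, hw⟩ := (splitInner_adj.1 hw).1
      exact absurd ‹_› (not_splitInner_adj_center (mem_innerNeighbors.2 ⟨hw, huw⟩))
    obtain ⟨hb', hb'A⟩ := mem_sdiff.1 hb'
    obtain ⟨hb'X, hub'⟩ := mem_innerNeighbors.1 hb'
    have hub'_reachable : (splitGraph G X u z A).Reachable u b' :=
      (le_attachVertex _ _ _ (splitInner_adj_center hub' hs.center_mem hb'X hb'A)).reachable
    exact (hub'_reachable.trans (hs.splitGraph_reachable_of_ne hb'X hub'.ne' hbb')).trans
      (attachVertex_adj_right hb (ne_of_mem_of_not_mem (hs.mem_and_adj b hb).1 hz)).reachable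
  have hdeg_le := hG.degree_le u
  refine hG.isFColorable_attachVertex (splitInner_le G X u A) (not_splitInner_adj hz) hcard
    splitBound_self (fun v hvz => ?_) (fun v hvz w hvw hv => ?_)
    fun v hvz w hvw => hs.splitGraph_reachable hconn hz hreach hvz hvw
  · rcases eq_or_ne v u with rfl | hvu
    · rw [splitBound_center huz, Nat.sub_one_mul]
      change (splitGraph G X v z A).degree v ≤ _
      omega
    · rw [splitBound_of_ne hvu hvz]
      exact (hs.degree_splitGraph_le hvz).trans (hG.degree_le v)
  · change (splitGraph G X u z A).degree v = _ at hv
    have hpos := ((splitGraph G X u z A).degree_pos_iff_exists_adj v).2 ⟨w, hvw⟩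
    rcases eq_or_ne v u with rfl | hvu
    · rw [splitBound_center huz, Nat.sub_one_mul] at hv
      omega
    · rw [splitBound_of_ne hvu hvz] at hv
      exact (hG.degree_le v).antisymm (hv ▸ hs.degree_splitGraph_le hvz)

theorem exists_injOn_union_eqOn_compl {ι α : Type*} [Fintype α] [Nonempty α] {s t : Finset ι}
    {g : ι → α} (hg : Set.InjOn g s) (hst : Disjoint s t) (hcard : #s + #t ≤ Fintype.card α) :
    ∃ g' : ι → α, Set.InjOn g' (s ∪ t) ∧ Set.EqOn g' g (tᶜ : Set ι) := by
  have hcompl : #t ≤ #(s.image g)ᶜ := by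
    rw [card_compl, card_image_of_injOn hg]
    omega
  rw [← Nat.cast_le (α := ℕ∞), ← Set.encard_coe_eq_coe_finsetCard,
    ← Set.encard_coe_eq_coe_finsetCard] at hcompl
  obtain ⟨ψ, hψ, hψ_inj⟩ := (finite_toSet _).exists_injOn_of_encard_le hcompl
  have hs (i : ι) (hi : i ∈ s) : t.piecewise ψ g i = g i :=
    piecewise_eq_of_notMem _ _ _ (disjoint_left.1 hst hi)
  have ht (i : ι) (hi : i ∈ t) : t.piecewise ψ g i = ψ i := piecewise_eq_of_mem _ _ _ hi
  refine ⟨t.piecewise ψ g, (Set.injOn_union (disjoint_coe.2 hst)).2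
    ⟨hg.congr fun i hi => (hs i hi).symm, hψ_inj.congr fun i hi => (ht i hi).symm, ?_⟩,
    fun i hi => piecewise_eq_of_notMem _ _ _ hi⟩
  intro i hi j hj h
  rw [hs i hi, ht j hj] at h
  exact mem_compl.1 (hψ hj) (mem_image.2 ⟨i, hi, h⟩)

theorem IsStarSplit.exists_coloring_of_splitGraph {α : Type*} [Fintype α] [Nonempty α]
    (hs : IsStarSplit G X u A) (hcard : #A + #(boundary G X) ≤ Fintype.card α) {c' : Sym2 V → α}
    (hc' : Set.InjOn (fun w => c' s(w, z)) A) :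
    ∃ c : Sym2 V → α, (∀ v w, (splitInner G X u A).Adj v w → c s(v, w) = c' s(v, w)) ∧
      (∀ w ∈ A, c s(u, w) = c' s(w, z)) ∧
      Set.InjOn c ((A.image fun w => s(u, w)) ∪ boundary G X) := by
  let moved := A.image fun w => s(u, w)
  let g (e : Sym2 V) : α := c' (if e ∈ moved then e.map (Function.update id u z) else e)
  have hg (w : V) (hw : w ∈ A) : g s(u, w) = c' s(w, z) := by
    rw [show g s(u, w) = _ from congrArg c' (if_pos (mem_image_of_mem _ hw)), Sym2.map_mk,
      Function.update_self, Function.update_of_ne (hs.mem_and_adj w hw).2.ne', id, Sym2.eq_swap]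
  have hg_inj : Set.InjOn g moved := by
    simp only [moved, coe_image, Set.InjOn, Set.forall_mem_image]
    intro w hw w' hw' h
    rw [hg w hw, hg w' hw'] at h
    rw [hc' hw hw' h]
  have notMem_boundary {v w : V} (hv : v ∈ X) (hw : w ∈ X) : s(v, w) ∉ boundary G X :=
    fun h => (mk_mem_boundary_iff.1 h).2.elim (·.2 hw) (·.1 hv)
  have hA (w : V) (hw : w ∈ A) : s(u, w) ∉ boundary G X :=
    notMem_boundary hs.center_mem (hs.mem_and_adj w hw).1
  obtain ⟨c, hc_inj, hc⟩ := exists_injOn_union_eqOn_compl hg_inj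
    (disjoint_left.2 (forall_mem_image.2 hA)) ((Nat.add_le_add_right card_image_le _).trans hcard)
  refine ⟨c, fun v w h => ?_, fun w hw => (hc (hA w hw)).trans (hg w hw), hc_inj⟩
  obtain ⟨⟨-, hv, hw⟩, hvw⟩ := splitInner_adj.1 h
  have hmoved : s(v, w) ∉ moved := by simpa only [moved, mem_image, not_exists, not_and] using hvw
  exact (hc (notMem_boundary hv hw)).trans (congrArg c' (if_neg hmoved))

theorem IsStarSplit.injOn_of_isFColoringOn {α : Type*} (hs : IsStarSplit G X u A) (hz : z ∉ X)
    {c' : Sym2 V → α} (hc' : IsFColoringOn (splitGraph G X u z A) (splitBound f u z) c') :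
    Set.InjOn (fun w => c' s(w, z)) A := by
  have adj_z {w : V} (hw : w ∈ A) : (splitGraph G X u z A).Adj z w :=
    (attachVertex_adj_right hw (ne_of_mem_of_not_mem (hs.mem_and_adj w hw).1 hz)).symm
  intro w hw w' hw' h
  exact eq_of_colorDegree_le_one ((hc' z _).trans_eq splitBound_self) (adj_z hw)
    (congrArg c' Sym2.eq_swap) (adj_z hw') ((congrArg c' Sym2.eq_swap).trans h.symm)

theorem colorDegree_center_le {α : Type*} (hu : u ∈ X) {c c' : Sym2 V → α}
    (hc : ∀ v w, (splitInner G X u A).Adj v w → c s(v, w) = c' s(v, w))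
    (hc_inj : Set.InjOn c ((A.image fun w => s(u, w)) ∪ boundary G X)) (a : α) :
    colorDegree G c u a ≤ colorDegree (splitGraph G X u z A) c' u a + 1 := by
  have hcover : ({w | G.Adj u w ∧ c s(u, w) = a} : Finset V) ⊆
      ({w | (splitGraph G X u z A).Adj u w ∧ c' s(u, w) = a} : Finset V) ∪
        ({w | G.Adj u w ∧ (w ∈ X → w ∈ A) ∧ c s(u, w) = a} : Finset V) := by
    intro w hw
    simp only [mem_union, mem_filter, mem_univ, true_and] at hw ⊢
    refine (em (w ∈ X → w ∈ A)).symm.imp (fun h => ?_) fun h => ⟨hw.1, h, hw.2⟩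
    obtain ⟨hwX, hwA⟩ := Classical.not_imp.1 h
    have huw := splitInner_adj_center hw.1 hu hwX hwA
    exact ⟨le_attachVertex _ _ _ huw, hc u w huw ▸ hw.2⟩
  refine (card_le_card hcover).trans ((card_union_le _ _).trans (Nat.add_le_add_left ?_ _))
  have mem_union {w : V} (huw : G.Adj u w) (hw : w ∈ X → w ∈ A) :
      s(u, w) ∈ (↑(A.image fun w => s(u, w)) ∪ ↑(boundary G X) : Set (Sym2 V)) :=
    (em (w ∈ X)).imp (fun h => mem_coe.2 (mem_image_of_mem _ (hw h))) (mk_mem_boundary huw hu)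
  refine card_le_one.2 fun p hp q hq => ?_
  obtain ⟨-, hup, hpA, hpa⟩ := mem_filter.1 hp
  obtain ⟨-, huq, hqA, hqa⟩ := mem_filter.1 hq
  exact Sym2.congr_right.1 (hc_inj (mem_union hup hpA) (mem_union huq hqA) (hpa.trans hqa.symm))

theorem IsStarSplit.exists_isSideColoring_of_splitGraph {α : Type*} [Fintype α] [Nonempty α]
    (hs : IsStarSplit G X u A) (hz : z ∉ X) (hu : 0 < f u)
    (hcard : #A + #(boundary G X) ≤ Fintype.card α) {c' : Sym2 V → α}
    (hc' : IsFColoringOn (splitGraph G X u z A) (splitBound f u z) c') :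
    ∃ c : Sym2 V → α, IsSideColoring G f X c := by
  obtain ⟨c, hc_inner, hcA, hc_inj⟩ :=
    hs.exists_coloring_of_splitGraph hcard (hs.injOn_of_isFColoringOn hz hc')
  refine ⟨c, fun v hv a => ?_, hc_inj.mono Set.subset_union_right⟩
  have hvz := ne_of_mem_of_not_mem hv hz
  rcases eq_or_ne v u with rfl | hvu
  · have hcenter := hc' v a
    rw [splitBound_center hvz] at hcenter
    calc colorDegree G c v a ≤ colorDegree (splitGraph G X v z A) c' v a + 1 :=
          colorDegree_center_le hv hc_inner hc_inj a
      _ ≤ f v - 1 + 1 := Nat.add_le_add_right hcenter 1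
      _ = f v := Nat.sub_add_cancel hu
  · have hlost {q : V} (hq : q ∈ G.neighborSet v \ (splitInner G X u A).neighborSet v) :
        q = u ∧ v ∈ A := hs.eq_center_and_mem hv hvu hq.1 hq.2
    refine (colorDegree_le_colorDegree_attachVertex (not_splitInner_adj hz) hvz (hc_inner v)
      (fun q hvq hq => ?_) (fun q hq q' hq' => (hlost hq).1.trans (hlost hq').1.symm) a).trans
      ((hc' v a).trans_eq (splitBound_of_ne hvu hvz))
    obtain ⟨rfl, hvA⟩ := hlost ⟨hvq, hq⟩
    exact ⟨hvA, (congrArg c Sym2.eq_swap).trans (hcA v hvA)⟩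

end Split

section StarCut

variable {V : Type*} [Fintype V] {G : SimpleGraph V} {f : V → ℕ} {k : ℕ} {X : Set V}
  {A : Finset V} {b u z : V}

theorem IsStarSplit.exists_isSideColoring (hs : IsStarSplit G X u A) (hG : HasSparseCore G f k)
    (hconn : G.Preconnected) (hz : z ∉ X) (hu : 0 < f u) (hcard : #A + 2 ≤ k)
    (hcard_boundary : #A + #(boundary G X) ≤ k)
    (hA : A = innerNeighbors G X u ∨ #A + #(boundary G X) = k ∧
      ∃ b' ∈ innerNeighbors G X u \ A, ∃ b ∈ A, (G.deleteIncidenceSet u).Reachable b' b) :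
    ∃ c : Sym2 V → Fin k, IsSideColoring G f X c := by
  have : NeZero k := ⟨by omega⟩
  obtain ⟨c', hc'⟩ := (isFColorable_iff (by omega)).1
    (hs.isFColorable_splitGraph hG hconn hz hcard hA)
  exact hs.exists_isSideColoring_of_splitGraph hz hu (by rwa [Fintype.card_fin]) hc'

theorem exists_isSideColoring_of_star (hG : HasSparseCore G f k) (hconn : G.Preconnected)
    (hu : u ∈ X) (hz : z ∉ X) (hstar : ∀ v ∈ X, ∀ w ∉ X, G.Adj v w → v = u)
    (hcard : #(boundary G X) + 2 ≤ k) (hcard' : 2 ≤ #(boundary G X))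
    (hN : ∀ b ∈ innerNeighbors G X u, ∃ v ∈ (innerNeighbors G X u).erase b,
      (G.deleteIncidenceSet u).Reachable b v) :
    ∃ c : Sym2 V → Fin k, IsSideColoring G f X c := by
  have hs : IsStarSplit G X u (innerNeighbors G X u) := ⟨hu, hstar, fun w => mem_innerNeighbors.1⟩
  have hdeg := hs.card_innerNeighbors_add_card_boundary
  have hfu : 0 < f u := Nat.pos_of_ne_zero fun h => by
    have := hG.degree_le u
    rw [h, Nat.zero_mul] at this
    omega
  rcases le_or_gt (G.degree u) k with hk | hk
  · exact hs.exists_isSideColoring hG hconn hz hfu (by omega) (by omega) (.inl rfl)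
  obtain ⟨b, hb⟩ : (innerNeighbors G X u).Nonempty := card_pos.1 (by omega)
  obtain ⟨v, hv, hbv⟩ := hN b hb
  have hcard_erase := card_erase_of_mem hb
  obtain ⟨A, hvA, hAN, hA⟩ := exists_subsuperset_card_eq (n := k - #(boundary G X))
    (singleton_subset_iff.2 hv) (by rw [card_singleton]; omega) (by omega)
  exact IsStarSplit.exists_isSideColoring
    ⟨hu, hstar, fun w hw => mem_innerNeighbors.1 (mem_of_mem_erase (hAN hw))⟩ hG hconn hz hfu
    (by omega) (by omega) (.inr ⟨by omega, b,
      mem_sdiff.2 ⟨hb, fun h => notMem_erase b _ (hAN h)⟩, v, singleton_subset_iff.1 hvA, hbv⟩)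

theorem isFColorable_of_forall_not_reachable (hG : HasSparseCore G f k) (hconn : G.Preconnected)
    (hstar : ∀ v ∈ X, ∀ w ∉ X, G.Adj v w → v = u) (hk : 3 ≤ k) (hb : b ∈ innerNeighbors G X u)
    (hN : ∀ v ∈ (innerNeighbors G X u).erase b, ¬ (G.deleteIncidenceSet u).Reachable b v) :
    IsFColorable G f k := by
  obtain ⟨hbX, hub⟩ := mem_innerNeighbors.1 hb
  let C : Set V := {v | v ∈ X ∧ v ≠ u ∧ (G.deleteIncidenceSet u).Reachable b v}
  have hC : boundary G C ⊆ {s(b, u)} := by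
    intro e he
    obtain ⟨p, q, rfl, hpq, ⟨hp, hpu, hbp⟩, hq⟩ := mem_boundary.1 he
    have hqX : q ∈ X := by_contra fun h => hpu (hstar p hp q h hpq)
    obtain rfl : q = u := by_contra fun hqu => hq ⟨hqX, hqu,
      hbp.trans (SimpleGraph.deleteIncidenceSet_adj.2 ⟨hpq, hpu, hqu⟩).reachable⟩
    obtain rfl : p = b := by_contra fun hpb =>
      hN p (mem_erase.2 ⟨hpb, mem_innerNeighbors.2 ⟨hp, hpq.symm⟩⟩) hbp
    exact mem_singleton_self _
  have hC_card : #(boundary G C) ≤ 1 := card_le_card hC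
  exact isFColorable_of_card_boundary_le_one (X := C) (x := b) hG hconn ⟨hbX, hub.ne', .rfl⟩
    (fun h => h.2.1 rfl) (by omega) hC_card

theorem isFColorable_of_star (hG : HasSparseCore G f k) (hconn : G.Preconnected) (hu : u ∈ X)
    (hz : z ∉ X) (hstar : ∀ v ∈ X, ∀ w ∉ X, G.Adj v w → v = u)
    (hcard : #(boundary G X) + 2 ≤ k) : IsFColorable G f k := by
  rcases le_or_gt #(boundary G X) 1 with hle | hcard'
  · exact isFColorable_of_card_boundary_le_one hG hconn hu hz hcard hle
  by_cases hN : ∀ b ∈ innerNeighbors G X u, ∃ v ∈ (innerNeighbors G X u).erase b,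
      (G.deleteIncidenceSet u).Reachable b v
  · obtain ⟨c₁, hc₁⟩ := exists_isSideColoring_of_star hG hconn hu hz hstar hcard hcard' hN
    obtain ⟨c₂, hc₂⟩ := exists_isSideColoring_of_subsingleton (X := Xᶜ) hG hconn (not_not.2 hu)
      (fun v hv w hw w' hw' =>
        (hstar w (not_not.1 hw.2) v hv hw.1.symm).trans
          (hstar w' (not_not.1 hw'.2) v hv hw'.1.symm).symm)
      (by rwa [boundary_compl])
    exact hc₁.isFColorable (by omega) hc₂
  · push Not at hN
    obtain ⟨b, hb, hN⟩ := hN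
    exact isFColorable_of_forall_not_reachable hG hconn hstar (by omega) hb hN

end StarCut

section EdgeCut

variable {V : Type*} [Fintype V] {G : SimpleGraph V} {f : V → ℕ} {k : ℕ} {F : Finset (Sym2 V)}

theorem IsEdgeCut.exists_boundary_subset (hF : IsEdgeCut G F) :
    ∃ (X : Set V) (x z : V), x ∈ X ∧ z ∉ X ∧ boundary G X ⊆ F := by
  set H := G.deleteEdges (F : Set (Sym2 V))
  obtain ⟨x, z, hxz⟩ : ∃ x z, ¬ H.Reachable x z := by
    by_contra! h
    have := SimpleGraph.Preconnected.subsingleton_connectedComponent h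
    let φ : H →g G := .ofLE (G.deleteEdges_le _)
    exact hF.2.not_ge
      (Nat.card_le_card_of_injective (·.map φ) (Function.injective_of_subsingleton _))
  refine ⟨{v | H.Reachable x v}, x, z, .rfl, hxz, fun e he => by_contra fun heF => ?_⟩
  obtain ⟨u, w, rfl, huw, hu, hw⟩ := mem_boundary.1 he
  exact hw (hu.trans (SimpleGraph.deleteEdges_adj.2 ⟨huw, heF⟩).reachable)

theorem HasSparseCore.isFColorable_of_isEdgeCut (hG : HasSparseCore G f k)
    (hconn : G.Connected) (hcut : IsEdgeCut G F) (hcard : #F + 2 ≤ k)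
    (hF : IsMatchingEdges F ∨ IsStarEdges F) : IsFColorable G f k := by
  obtain ⟨X, x, z, hx, hz, hXF⟩ := hcut.exists_boundary_subset
  have hcard' : #(boundary G X) + 2 ≤ k := (Nat.add_le_add_right (card_le_card hXF) 2).trans hcard
  rcases hF with hmatching | ⟨u, hu⟩
  · exact isFColorable_of_isMatchingEdges_boundary hG hconn.preconnected hx hz hcard'
      fun e he e' he' => hmatching e (hXF he) e' (hXF he')
  have eq_or_eq {v w : V} (hv : v ∈ X) (hw : w ∉ X) (hvw : G.Adj v w) : u = v ∨ u = w :=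
    Sym2.mem_iff.1 (hu _ (hXF (mk_mem_boundary hvw hv hw)))
  by_cases huX : u ∈ X
  · exact isFColorable_of_star hG hconn.preconnected huX hz (fun v hv w hw hvw =>
      ((eq_or_eq hv hw hvw).resolve_right (ne_of_mem_of_not_mem huX hw)).symm) hcard'
  · refine isFColorable_of_star (X := Xᶜ) hG hconn.preconnected huX (not_not.2 hx)
      (fun v hv w hw hvw => ?_) (by rwa [boundary_compl])
    have hw := not_not.1 hw
    exact ((eq_or_eq hw hv hvw.symm).resolve_left (ne_of_mem_of_not_mem hw huX).symm).symm

theorem degree_le_mul_fMaxDegree (hf : ∀ v, 0 < f v) (v : V) :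
    G.degree v ≤ f v * fMaxDegree G f := by
  have h : ⌈(G.degree v : ℚ) / (f v : ℚ)⌉₊ ≤ fMaxDegree G f :=
    Finset.le_sup (f := fun v => ⌈(G.degree v : ℚ) / (f v : ℚ)⌉₊) (mem_univ v)
  rw [Nat.ceil_le, div_le_iff₀ (Nat.cast_pos.2 (hf v)), mul_comm] at h
  exact_mod_cast h

theorem fMaxDegree_le_of_isFColorable (hf : ∀ v, 0 < f v) (h : IsFColorable G f k) :
    fMaxDegree G f ≤ k := by
  refine Finset.sup_le fun v _ => ?_
  rw [Nat.ceil_le, div_le_iff₀ (Nat.cast_pos.2 (hf v)), mul_comm]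
  exact_mod_cast degree_le_of_isFColorable h v

theorem card_coreNeighbors_le_fCoreMaxDegree {v : V} (hv : G.degree v = f v * fMaxDegree G f) :
    #(coreNeighbors G f (fMaxDegree G f) v) ≤ fCoreMaxDegree G f := by
  refine le_trans ?_ ((fCore G f).degree_le_maxDegree ⟨v, hv⟩)
  rw [← SimpleGraph.card_neighborFinset_eq_degree]
  refine (card_le_card fun w hw => ?_).trans (card_image_le (f := Subtype.val))
  obtain ⟨hvw, hw⟩ := mem_coreNeighbors.1 hw
  exact mem_image.2 ⟨⟨w, hw⟩, (SimpleGraph.mem_neighborFinset ..).2 hvw, rfl⟩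

theorem hasSparseCore_of_fCoreMaxDegree_le (hf : ∀ v, 0 < f v) (h : fCoreMaxDegree G f ≤ 2) :
    HasSparseCore G f (fMaxDegree G f) :=
  ⟨degree_le_mul_fMaxDegree hf, fun _ hv => (card_coreNeighbors_le_fCoreMaxDegree hv).trans h⟩

end EdgeCut

end FColoring

theorem mainTheorem1 {V : Type*} [Fintype V] (G : SimpleGraph V) (hG : G.Connected)
    (f : V → ℕ) (hf : ∀ v, 0 < f v)
    (hcore : FColoring.fCoreMaxDegree G f ≤ 2)
    (F : Finset (Sym2 V)) (hcut : FColoring.IsEdgeCut G F)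
    (hsize : F.card + 2 ≤ FColoring.fMaxDegree G f)
    (hF : FColoring.IsMatchingEdges F ∨ FColoring.IsStarEdges F) :
    FColoring.IsFClassOne G f := by
  have hcol := (FColoring.hasSparseCore_of_fCoreMaxDegree_le hf hcore).isFColorable_of_isEdgeCut
    hG hcut hsize hF
  exact le_antisymm (Nat.sInf_le hcol) (FColoring.fMaxDegree_le_of_isFColorable hf
    (Nat.sInf_mem (FColoring.exists_isFColorable G f hf)))
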